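/- Let $a$ be a rational function with real coefficients that is even, $a(-z)=a(z)$, and all-pass, $a(z)a(z^{-1})=1$. Let $H$ be the real rational function corresponding to $a$ under the mutually inverse maps $$H=\beta\circ\frac{1}{(1+\sqrt2\,a)^2}\circ\beta^{-1},\qquad a=\frac{1+H(z)-H(-z)}{\sqrt2\,H(-z)}\circ\beta,\qquad \beta(z)=\frac{1-z}{1+z}=\beta^{-1}(z),$$ which relate the even all-pass functions $a$ to the 0-SYM filters $H$, i.e. the real rational functions with $H(z)^2+H(-z)^2=1$ and $H(z)=H(z^{-1})$. Assume that $H$ satisfies the low-pass condition $H(1)=1$, and let $m>0$ be an integer. The following conditions are equivalent: 1. $0$ is a pole of $a$ of multiplicity $2m$; 2. $-1$ is a zero of $H$ of multiplicity $2m$; 3. $1$ is a zero of $1-H$ of multiplicity $4m$. Write $\hat f(\xi)=\int_{\mathbf R} f(x)e^{-i\xi x}\,dx$ for the Fourier transform (on $L^2(\mathbf R)$), $m_0(\xi)=H(e^{-i\xi})$ and $m_1(\xi)=-e^{-i\xi}\,\overline{m_0(\xi+\pi)}$. The scaling function $\varphi\in L^2(\mathbf R)$ associated to $H$ is determined by $\hat\varphi(2\xi)=m_0(\xi)\hat\varphi(\xi)$,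 with $\hat\varphi$ continuous at $0$ and $\hat\varphi(0)=1$ (so $\hat\varphi(\xi)=\prod_{k\ge1}m_0(2^{-k}\xi)$), and the wavelet $\psi\in L^2(\mathbf R)$ by $\hat\psi(2\xi)=m_1(\xi)\hat\varphi(\xi)$. If any of the three conditions holds, then $\varphi$ and $\psi$ exist, and $$\int_{\mathbf R}x^k\psi(x)\,dx=0\quad(0\le k<2m),\qquad \int_{\mathbf R}x^k\varphi(x)\,dx=\delta_{k0}\quad(0\le k<4m),$$ all these integrals being absolutely convergent. -/

import Mathlib

open MeasureTheory FourierTransform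
open scoped ComplexConjugate

noncomputable section

namespace ZeroSym

/-- The composition `f ∘ g` of rational functions with real coefficients: `g` is substituted for
the variable in `f`.  (It is only used below where the denominator of `f` does not become the zero
rational function under the substitution: `g` is non-constant, or `f = β` and `g ≠ -1`.) -/
def comp (f g : RatFunc ℝ) : RatFunc ℝ := RatFunc.eval RatFunc.C g f

/-- The bilinear transformation `β(z) = (1 - z) / (1 + z)`, which is its own inverse under
composition. -/
def beta : RatFunc ℝ := (1 - RatFunc.X) / (1 + RatFunc.X)

/-- The constant rational function `√2`. -/
def sqrtTwo : RatFunc ℝ := RatFunc.C (Real.sqrt 2)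

/-- `a` is all-pass: `a(z) a(z⁻¹) = 1`. -/
def IsAllPass (a : RatFunc ℝ) : Prop := a * comp a RatFunc.X⁻¹ = 1

/-- `a` is even: `a(-z) = a(z)`. -/
def IsEven (a : RatFunc ℝ) : Prop := comp a (-RatFunc.X) = a

/-- `H` is a 0-SYM filter: `H(z)² + H(-z)² = 1` and `H(z) = H(z⁻¹)`. -/
def IsZeroSymFilter (H : RatFunc ℝ) : Prop :=
  H ^ 2 + (comp H (-RatFunc.X)) ^ 2 = 1 ∧ comp H RatFunc.X⁻¹ = H

/-- The map `a ↦ H = β ∘ (1 / (1 + √2 a)²) ∘ β⁻¹`, where `β⁻¹ = β`. -/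
def filterOfAllPass (a : RatFunc ℝ) : RatFunc ℝ :=
  comp (comp beta (1 / (1 + sqrtTwo * a) ^ 2)) beta

/-- The map `H ↦ a = ((1 + H(z) - H(-z)) / (√2 H(-z))) ∘ β`. -/
def allPassOfFilter (H : RatFunc ℝ) : RatFunc ℝ :=
  comp ((1 + H - comp H (-RatFunc.X)) / (sqrtTwo * comp H (-RatFunc.X))) beta

/-- `a` and `H` correspond to each other: either `a` is an even all-pass function and `H` is
its image, or `H` is a 0-SYM filter and `a` is its image, under the two maps above. -/
def Corresponds (a H : RatFunc ℝ) : Prop :=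
  (IsAllPass a ∧ IsEven a ∧ H = filterOfAllPass a) ∨
    (IsZeroSymFilter H ∧ a = allPassOfFilter H)

/-- The multiplicity of `c` as a zero of `f` (numerator and denominator are coprime). -/
def zeroMultiplicity (f : RatFunc ℝ) (c : ℝ) : ℕ := f.num.rootMultiplicity c

/-- The multiplicity of `c` as a pole of `f` (numerator and denominator are coprime). -/
def poleMultiplicity (f : RatFunc ℝ) (c : ℝ) : ℕ := f.denom.rootMultiplicity c

/-- The low-pass condition `H(1) = 1`. -/
def IsNormalized (H : RatFunc ℝ) : Prop := RatFunc.eval (RingHom.id ℝ) 1 H = 1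

/-- The frequency response `m₀(ξ) = H(e^{-iξ})`. -/
def freqResponse (H : RatFunc ℝ) (ξ : ℝ) : ℂ :=
  RatFunc.eval (algebraMap ℝ ℂ) (Complex.exp (-Complex.I * ξ)) H

/-- The wavelet filter `m₁(ξ) = -e^{-iξ} conj (m₀(ξ + π))`. -/
def waveletResponse (H : RatFunc ℝ) (ξ : ℝ) : ℂ :=
  -Complex.exp (-Complex.I * ξ) * conj (freqResponse H (ξ + Real.pi))

/-- The Fourier transform `f̂(ξ) = ∫ f(x) e^{-iξx} dx` on `L²(ℝ)` (defined up to null sets);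
Mathlib's `𝓕` has the kernel `e^{-2πiξx}`. -/
def angularFourier (f : Lp (α := ℝ) ℂ 2 volume) (ξ : ℝ) : ℂ :=
  ((𝓕 f : Lp (α := ℝ) ℂ 2 volume) : ℝ → ℂ) (ξ / (2 * Real.pi))

/-- `φ ∈ L²(ℝ)` is the scaling function of `H`: its Fourier transform has a representative `Φ`,
continuous at `0` with `Φ(0) = 1`, such that `Φ(2ξ) = m₀(ξ) Φ(ξ)`; that is,
`Φ(ξ) = ∏_{k ≥ 1} m₀(2^{-k} ξ)`. -/
def IsScalingFunction (H : RatFunc ℝ) (φ : Lp (α := ℝ) ℂ 2 volume) : Prop :=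
  ∃ Φ : ℝ → ℂ, angularFourier φ =ᵐ[volume] Φ ∧ ContinuousAt Φ 0 ∧ Φ 0 = 1 ∧
    ∀ ξ : ℝ, Φ (2 * ξ) = freqResponse H ξ * Φ ξ

/-- `ψ ∈ L²(ℝ)` is the wavelet obtained from `H` and the scaling function `φ`:
`ψ̂(2ξ) = m₁(ξ) φ̂(ξ)` for almost every `ξ`. -/
def IsWavelet (H : RatFunc ℝ) (φ ψ : Lp (α := ℝ) ℂ 2 volume) : Prop :=
  ∀ᵐ ξ : ℝ, angularFourier ψ (2 * ξ) = waveletResponse H ξ * angularFourier φ ξ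

/-- The `k`-th moment of `f` converges absolutely and `∫ x^k f(x) dx = c`. -/
def HasMoment (f : ℝ → ℂ) (k : ℕ) (c : ℂ) : Prop :=
  Integrable (fun x : ℝ => (x : ℂ) ^ k * f x) ∧ ∫ x : ℝ, (x : ℂ) ^ k * f x = c

end ZeroSym

end

noncomputable section

namespace ZeroSym

open scoped SchwartzMap ContDiff

/-! The equivalences are local algebra. Since `(1 - H)(1 + H) = H(-z)²` and `1 + H` equals `2` at
`1`, the zero of `1 - H` at `1` has twice the multiplicity of the zero of `H` at `-1`
(`zeroMultiplicity_one_sub_one`). Since `β(z) - 1 = -2z/(1 + z)` has a simple zero at `0`, a pole of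
`a` at `0` is a pole of `(1 + H - H(-z))/(√2 H(-z))` at `1` of the same multiplicity; the numerator
is `2` there, so the pole comes from the zero of `H(-z)` (`poleMultiplicity_allPassOfFilter`).

For the moments, `H` is real on the unit circle, so the quadrature identity gives `|H| ≤ 1` there
and excludes poles. Hence `m₀` extends to a holomorphic Lipschitz function `M` on a strip
(`exists_isStripSymbol`), and `Φ(z) = ∏ M(2⁻ᵏ z)` is holomorphic on that strip. Perturbing each
factor by a summable error costs only a bounded factor in the usual `L²` estimate for such products,
so `Φ` has an `L²` majorant that is uniform over complex discs of fixed radius (`exists_majorant`).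
Cauchy's estimates then put every derivative of `Φ` in `L²`, and likewise for `ψ̂`. So `xᵏφ` and
`xᵏψ` lie in `L²` for all `k`, hence in `L¹`, and the moments are `iᵏ` times the derivatives at `0`
(`hasMoment_of_hasDerivAt`).

These derivatives vanish for two reasons. `Φ(2z) - Φ(z) = (M(z) - 1)Φ(z)` vanishes to order `4m` at
`0`, which gives `(2ᵏ - 1)Φ⁽ᵏ⁾(0) = 0` for `k < 4m`; and `ψ̂` contains the factor `M(z/2 + π)`,
which vanishes to order `2m`. -/

/-! ### Fourier transform on `L²` and moments -/

theorem Lp.integral_fourier_mul_schwartz (f : Lp (α := ℝ) ℂ 2 volume) (u : 𝓢(ℝ, ℂ)) :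
    ∫ ξ, u ξ * (𝓕 f : Lp (α := ℝ) ℂ 2 volume) ξ = ∫ x, 𝓕 u x * f x := by
  have h := Lp.fourier_toTemperedDistribution_eq f
  have h2 := congrArg (fun T : 𝓢'(ℝ, ℂ) => T u) h
  simp only [TemperedDistribution.fourier_apply, Lp.toTemperedDistribution_apply] at h2
  simpa using h2.symm

theorem locallyIntegrable_Lp_two (f : Lp (α := ℝ) ℂ 2 volume) : LocallyIntegrable f volume :=
  (Lp.memLp f).locallyIntegrable (by norm_num)

theorem ae_eq_of_integral_schwartz_eq {f g : ℝ → ℂ} (hf : LocallyIntegrable f)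
    (hg : LocallyIntegrable g) (h : ∀ u : 𝓢(ℝ, ℂ), ∫ x, u x * f x = ∫ x, u x * g x) :
    f =ᵐ[volume] g := by
  apply ae_eq_of_integral_contDiff_smul_eq hf hg
  intro u hu hc
  have h1 : HasCompactSupport (Complex.ofRealCLM ∘ u) := hc.comp_left rfl
  have h2 : ContDiff ℝ ∞ (Complex.ofRealCLM ∘ u) := by fun_prop
  simpa using h (h1.toSchwartzMap h2)

/-- As `f` need not be integrable, the identity is tested against transforms `𝓕 u` of Schwartz
functions; integration by parts takes place on the frequency side, where `D` and `D'` are in `L²`.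
-/
theorem ae_eq_mul_of_hasDerivAt_fourier (f g : Lp (α := ℝ) ℂ 2 volume) (D D' : ℝ → ℂ)
    (hf : (𝓕 f : Lp (α := ℝ) ℂ 2 volume) =ᵐ[volume] D)
    (hg : (𝓕 g : Lp (α := ℝ) ℂ 2 volume) =ᵐ[volume] D')
    (hD : ∀ ξ, HasDerivAt D (D' ξ) ξ) :
    g =ᵐ[volume] fun x => (-2 * Real.pi * Complex.I * x) * f x := by
  have hD2 : MemLp D 2 := (memLp_congr_ae hf).1 (Lp.memLp _)
  have hD2' : MemLp D' 2 := (memLp_congr_ae hg).1 (Lp.memLp _)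
  have hsch (u : 𝓢(ℝ, ℂ)) : MemLp u 2 := u.memLp 2 volume
  apply ae_eq_of_integral_schwartz_eq (locallyIntegrable_Lp_two g)
  · exact (locallyIntegrable_Lp_two f).continuous_mul (by fun_prop)
  intro s
  obtain ⟨u, rfl⟩ : ∃ u : 𝓢(ℝ, ℂ), 𝓕 u = s := ⟨𝓕⁻ s, by simp⟩
  rw [← Lp.integral_fourier_mul_schwartz g u]
  have e1 : ∫ ξ, u ξ * (𝓕 g : Lp (α := ℝ) ℂ 2 volume) ξ = ∫ ξ, u ξ * D' ξ :=
    integral_congr_ae (hg.mono fun x hx => by simp only [hx])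
  have e2 : ∫ ξ, u ξ * D' ξ = - ∫ ξ, deriv u ξ * D ξ := by
    apply integral_mul_deriv_eq_deriv_mul_of_integrable (fun x _ => (u.differentiableAt).hasDerivAt)
      (fun x _ => hD x)
    · exact MemLp.integrable_mul (hsch u) hD2'
    · exact MemLp.integrable_mul (hsch (SchwartzMap.derivCLM ℂ ℂ u)) hD2
    · exact MemLp.integrable_mul (hsch u) hD2
  have e3 : ∫ ξ, deriv u ξ * D ξ = ∫ ξ, (SchwartzMap.derivCLM ℂ ℂ u) ξ *
      (𝓕 f : Lp (α := ℝ) ℂ 2 volume) ξ :=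
    integral_congr_ae (hf.mono fun x hx => by simp [hx])
  rw [e1, e2, e3, Lp.integral_fourier_mul_schwartz, ← integral_neg]
  congr 1
  ext x
  have e4 : 𝓕 (SchwartzMap.derivCLM ℂ ℂ u) x = 2 * Real.pi * Complex.I * x * 𝓕 u x := by
    have := congrFun (Real.fourier_deriv u.integrable u.differentiable
      ((SchwartzMap.derivCLM ℂ ℂ u).integrable (μ := volume))) x
    rw [SchwartzMap.fourier_coe, SchwartzMap.fourier_coe,
      show (SchwartzMap.derivCLM ℂ ℂ u : ℝ → ℂ) = deriv u from rfl]
    simpa using this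
  rw [e4]; ring

theorem fourier_ae_eq_of_integrable (f : Lp (α := ℝ) ℂ 2 volume) (hf : Integrable f) :
    (𝓕 f : Lp (α := ℝ) ℂ 2 volume) =ᵐ[volume] 𝓕 (f : ℝ → ℂ) := by
  apply ae_eq_of_integral_schwartz_eq (locallyIntegrable_Lp_two _)
  · exact (VectorFourier.fourierIntegral_continuous Real.continuous_fourierChar
      continuous_inner hf).locallyIntegrable
  intro u
  rw [Lp.integral_fourier_mul_schwartz]
  have := VectorFourier.integral_fourierIntegral_smul_eq_flip (L := innerₗ ℝ) 
    Real.continuous_fourierChar continuous_inner (u.integrable (μ := volume)) hf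
  simpa using! this

theorem ae_comp_mul_right {p : ℝ → Prop} (hp : ∀ᵐ x, p x) {c : ℝ} (hc : c ≠ 0) :
    ∀ᵐ x, p (x * c) := by
  refine ae_of_ae_map (f := fun x : ℝ => x * c) (by fun_prop) ?_
  rw [Real.map_volume_mul_right hc]
  exact Measure.ae_smul_measure hp _

theorem memLp_comp_mul_right {f : ℝ → ℂ} (hf : MemLp f 2) {c : ℝ} (hc : c ≠ 0) :
    MemLp (fun x => f (x * c)) 2 := by
  have h : MemLp f 2 (Measure.map (fun x : ℝ => x * c) volume) := by
    rw [Real.map_volume_mul_right hc]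
    exact hf.smul_measure ENNReal.ofReal_ne_top
  exact (memLp_map_measure_iff h.1 (by fun_prop)).1 h

theorem integrable_of_memLp_two_of_mul {f : ℝ → ℂ} (hf : MemLp f 2)
    (hxf : MemLp (fun x : ℝ => (x : ℂ) * f x) 2) : Integrable f := by
  have h1 := (memLp_two_iff_integrable_sq_norm hf.1).1 hf
  have h2 := (memLp_two_iff_integrable_sq_norm hxf.1).1 hxf
  refine ((integrable_inv_one_add_sq.add h1).add h2).mono' hf.1 (.of_forall fun x => ?_)
  simp only [Pi.add_apply, norm_mul, Complex.norm_real, mul_pow, Real.norm_eq_abs, sq_abs]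
  have hp : 0 < 1 + x ^ 2 := by positivity
  have := sq_nonneg ((1 + x ^ 2) * ‖f x‖ - 1)
  -- This amounts to `|f| ≤ (1 + x²)⁻¹ + (1 + x²)|f|²`, by completing the square.
  have e : (1 + x ^ 2)⁻¹ + ‖f x‖ ^ 2 + x ^ 2 * ‖f x‖ ^ 2 - ‖f x‖ =
    (1 + x ^ 2)⁻¹ * (((1 + x ^ 2) * ‖f x‖ - 1) ^ 2 + (1 + x ^ 2) * ‖f x‖) := by
    field_simp; ring
  have : 0 ≤ (1 + x ^ 2)⁻¹ * (((1 + x ^ 2) * ‖f x‖ - 1) ^ 2 + (1 + x ^ 2) * ‖f x‖) := by positivity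
  linarith

/-- The inverse transform of the `k`-th derivative is `xᵏ f` up to a constant. It is integrable
because its product with `x`, coming from the next derivative, is also in `L²`. -/
theorem hasMoment_of_hasDerivAt (f : Lp (α := ℝ) ℂ 2 volume) (D : ℕ → ℝ → ℂ)
    (hD : ∀ k ξ, HasDerivAt (D k) (D (k + 1) ξ) ξ) (hL : ∀ k, MemLp (D k) 2)
    (hf : angularFourier f =ᵐ[volume] D 0) (k : ℕ) :
    HasMoment f k (Complex.I ^ k * D k 0) := by
  have hpi : (2 * Real.pi) ≠ 0 := by positivity
  -- The derivatives rescaled to the kernel `e^{-2πiξx}`; the chain rule produces the powers of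
  -- `2π`.
  set E : ℕ → ℝ → ℂ := fun k ξ => (2 * Real.pi : ℝ) ^ k * D k (ξ * (2 * Real.pi)) with hE
  have hE' (k ξ) : HasDerivAt (E k) (E (k + 1) ξ) ξ := by
    have h1 : HasDerivAt (fun ξ : ℝ => ξ * (2 * Real.pi)) (2 * Real.pi) ξ := by
      simpa using (hasDerivAt_id ξ).mul_const (2 * Real.pi)
    have := ((hD k (ξ * (2 * Real.pi))).scomp ξ h1).const_mul (((2 * Real.pi : ℝ) : ℂ) ^ k)
    refine this.congr_deriv ?_
    simp only [hE, Complex.real_smul]; ring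
  have hEL (k) : MemLp (E k) 2 := by
    apply MemLp.const_mul
    exact memLp_comp_mul_right (hL k) hpi
  have hE0 : (𝓕 f : Lp (α := ℝ) ℂ 2 volume) =ᵐ[volume] E 0 := by
    filter_upwards [ae_comp_mul_right hf hpi] with ξ h
    simpa [angularFourier, hE, hpi] using h
  let F (k : ℕ) : Lp (α := ℝ) ℂ 2 volume := 𝓕⁻ ((hEL k).toLp)
  have hF (k) : (𝓕 (F k) : Lp (α := ℝ) ℂ 2 volume) =ᵐ[volume] E k := by
    simp only [F, FourierTransform.fourier_fourierInv_eq]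
    exact MemLp.coeFn_toLp _
  have hF0 : f = F 0 := by
    have : 𝓕 f = (hEL 0).toLp := by
      ext1; exact hE0.trans (MemLp.coeFn_toLp _).symm
    simp [F, ← this]
  have hFs (k) : F (k + 1) =ᵐ[volume] fun x => (-2 * Real.pi * Complex.I * x) * F k x :=
    ae_eq_mul_of_hasDerivAt_fourier _ _ _ _ (hF k) (hF (k + 1)) (hE' k)
  have hFk (k) : F k =ᵐ[volume] fun x => (-2 * Real.pi * Complex.I) ^ k * ((x : ℂ) ^ k * f x) := by
    induction k with
    | zero => simp [hF0]
    | succ k ih =>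
      filter_upwards [hFs k, ih] with x h1 h2
      rw [h1, h2]; ring
  have hc : (-2 * Real.pi * Complex.I : ℂ) ≠ 0 := by simp [Real.pi_ne_zero]
  have hInt : Integrable (F k) := by
    apply integrable_of_memLp_two_of_mul (Lp.memLp _)
    refine ((memLp_congr_ae ?_).1 ((Lp.memLp (F (k + 1))).const_mul (-2 * Real.pi * Complex.I)⁻¹))
    filter_upwards [hFs k] with x h
    rw [h]; field_simp
  have hval : ∫ x, F k x = E k 0 := by
    have h1 := (fourier_ae_eq_of_integrable _ hInt).symm.trans (hF k)
    -- Both sides are continuous, so equality almost everywhere becomes equality everywhere and can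
    -- be evaluated at `0`.
    have h2 : 𝓕 (F k : ℝ → ℂ) = E k := by
      refine (Continuous.ae_eq_iff_eq volume ?_ ?_).1 h1
      · exact (VectorFourier.fourierIntegral_continuous Real.continuous_fourierChar
          continuous_inner hInt)
      · exact continuous_iff_continuousAt.2 fun x => (hE' k x).continuousAt
    rw [← h2, Real.fourier_eq]
    simp
  have h3 := hInt.congr (hFk k)
  rw [integrable_const_mul_iff (pow_ne_zero k hc).isUnit] at h3
  refine ⟨h3, ?_⟩
  rw [integral_congr_ae (hFk k), integral_const_mul] at hval
  simp only [hE, zero_mul] at hval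
  apply mul_left_cancel₀ (pow_ne_zero k hc)
  rw [hval, ← mul_assoc, ← mul_pow]
  congr 2
  push_cast
  ring_nf; simp

/-! ### Integral bounds for dyadic products -/

open Filter Topology

/-- The dyadic product `∏_{k < n} p_k(2^{-(k+1)} ξ)`. -/
def dyadicProd {R : Type*} [CommMonoid R] (p : ℕ → ℝ → R) (n : ℕ) (ξ : ℝ) : R :=
  ∏ k ∈ Finset.range n, p k (ξ / 2 ^ (k + 1))

theorem dyadicProd_periodic {p : ℕ → ℝ → ℝ} (hper : ∀ k, Function.Periodic (p k) (2 * Real.pi))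
    (n : ℕ) : Function.Periodic (dyadicProd p n) (2 ^ n * (2 * Real.pi)) := by
  intro ξ
  refine Finset.prod_congr rfl fun k hk => ?_
  obtain ⟨j, rfl⟩ : ∃ j, n = k + 1 + j := ⟨n - (k + 1), by have := Finset.mem_range.1 hk; omega⟩
  have : (ξ + 2 ^ (k + 1 + j) * (2 * Real.pi)) / 2 ^ (k + 1) =
      ξ / 2 ^ (k + 1) + ((2 ^ j : ℕ) : ℝ) * (2 * Real.pi) := by
    rw [pow_add]; push_cast; field_simp
  rw [this]
  exact (hper k).nat_mul _ _

theorem continuous_dyadicProd {p : ℕ → ℝ → ℝ} (hp : ∀ k, Continuous (p k)) (n : ℕ) :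
    Continuous (dyadicProd p n) :=
  continuous_finsetProd _ fun k _ => (hp k).comp (by fun_prop)

/-- Fold the interval in half: a shift by half its length fixes all factors but the last, whose
argument moves by `π`, so the two halves combine through `hpc`. -/
theorem integral_dyadicProd_le {p : ℕ → ℝ → ℝ} (hper : ∀ k, Function.Periodic (p k) (2 * Real.pi))
    (hp : ∀ k, Continuous (p k)) (hnn : ∀ k t, 0 ≤ p k t) {c : ℕ → ℝ} (hc : ∀ k, 0 ≤ c k)
    (hpc : ∀ k t, p k t + p k (t + Real.pi) ≤ c k) (n : ℕ) :
    ∫ ξ in (0)..(2 ^ n * (2 * Real.pi)), dyadicProd p n ξ ≤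
      2 * Real.pi * ∏ k ∈ Finset.range n, c k := by
  induction n with
  | zero => simp [dyadicProd]
  | succ n ih =>
    set T : ℝ := 2 ^ n * (2 * Real.pi) with hT
    have hT0 : 0 ≤ T := by positivity
    have hTT : 2 ^ (n + 1) * (2 * Real.pi) = T + T := by rw [hT]; ring
    have hcont := continuous_dyadicProd hp
    rw [hTT, ← intervalIntegral.integral_add_adjacent_intervals (b := T)
      ((hcont _).intervalIntegrable _ _) ((hcont _).intervalIntegrable _ _)]
    have h1 : ∫ ξ in T..(T + T), dyadicProd p (n + 1) ξ =
        ∫ ξ in (0)..T, dyadicProd p (n + 1) (ξ + T) := by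
      rw [intervalIntegral.integral_comp_add_right]; simp
    have hcont2 : Continuous fun ξ => dyadicProd p (n + 1) (ξ + T) :=
      (hcont _).comp (by fun_prop)
    rw [h1, ← intervalIntegral.integral_add ((hcont _).intervalIntegrable _ _)
      (hcont2.intervalIntegrable _ _), Finset.prod_range_succ]
    have h2 : ∀ ξ, dyadicProd p (n + 1) ξ + dyadicProd p (n + 1) (ξ + T) ≤
        c n * dyadicProd p n ξ := by
      intro ξ
      have e : dyadicProd p n (ξ + T) = dyadicProd p n ξ := dyadicProd_periodic hper n ξ
      have e2 : (ξ + T) / 2 ^ (n + 1) = ξ / 2 ^ (n + 1) + Real.pi := by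
        rw [hT, pow_succ]; field_simp
      have hs (x) : dyadicProd p (n + 1) x = dyadicProd p n x * p n (x / 2 ^ (n + 1)) :=
        Finset.prod_range_succ _ _
      rw [hs, hs, e, e2, ← mul_add, mul_comm]
      exact mul_le_mul_of_nonneg_right (hpc _ _) (Finset.prod_nonneg fun k _ => hnn _ _)
    calc _ ≤ ∫ ξ in (0)..T, c n * dyadicProd p n ξ := by
          refine intervalIntegral.integral_mono_on hT0
            (((hcont _).add hcont2).intervalIntegrable _ _)
            ((continuous_const.mul (hcont _)).intervalIntegrable _ _) fun ξ _ => h2 ξ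
      _ = c n * ∫ ξ in (0)..T, dyadicProd p n ξ := intervalIntegral.integral_const_mul _ _
      _ ≤ c n * (2 * Real.pi * ∏ k ∈ Finset.range n, c k) :=
          mul_le_mul_of_nonneg_left ih (hc n)
      _ = _ := by ring

/-- Fatou's lemma, applied to the partial products cut off to one centred period; these periods
exhaust the line. -/
theorem lintegral_ofReal_le_of_tendsto_dyadicProd {p : ℕ → ℝ → ℝ}
    (hper : ∀ k, Function.Periodic (p k) (2 * Real.pi))
    (hp : ∀ k, Continuous (p k)) (hnn : ∀ k t, 0 ≤ p k t) {c : ℕ → ℝ} (hc : ∀ k, 0 ≤ c k)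
    (hpc : ∀ k t, p k t + p k (t + Real.pi) ≤ c k) {B : ℝ}
    (hB : ∀ n, ∏ k ∈ Finset.range n, c k ≤ B) {P : ℝ → ℝ}
    (hP : ∀ ξ, Tendsto (fun n => dyadicProd p n ξ) atTop (𝓝 (P ξ))) :
    ∫⁻ ξ, ENNReal.ofReal (P ξ) ≤ ENNReal.ofReal (2 * Real.pi * B) := by
  set f : ℕ → ℝ → ENNReal := fun n => (Set.Ioc (-(2 ^ n * Real.pi)) (2 ^ n * Real.pi)).indicator
    (fun ξ => ENNReal.ofReal (dyadicProd p n ξ)) with hf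
  have hcont := continuous_dyadicProd hp
  have hlim (ξ) : ENNReal.ofReal (P ξ) = liminf (fun n => f n ξ) atTop := by
    refine (Tendsto.liminf_eq ?_).symm
    refine (ENNReal.tendsto_ofReal (hP ξ)).congr' ?_
    have h1 : Tendsto (fun n : ℕ => (2 : ℝ) ^ n * Real.pi) atTop atTop :=
      (tendsto_pow_atTop_atTop_of_one_lt one_lt_two).atTop_mul_const Real.pi_pos
    filter_upwards [h1.eventually_gt_atTop |ξ|] with n hn
    simp only [hf]
    rw [Set.indicator_of_mem]
    exact ⟨(abs_lt.1 hn).1, (abs_lt.1 hn).2.le⟩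
  have hint (n) : ∫⁻ ξ, f n ξ ≤ ENNReal.ofReal (2 * Real.pi * B) := by
    rw [lintegral_indicator measurableSet_Ioc, ← ofReal_integral_eq_lintegral_ofReal
      ((hcont n).integrableOn_Ioc) (.of_forall fun ξ => Finset.prod_nonneg fun k _ => hnn _ _)]
    apply ENNReal.ofReal_le_ofReal
    rw [← intervalIntegral.integral_of_le (by linarith [show 0 < 2 ^ n * Real.pi by positivity])]
    have := (dyadicProd_periodic hper n).intervalIntegral_add_eq (-(2 ^ n * Real.pi)) 0
    rw [show -(2 ^ n * Real.pi) + 2 ^ n * (2 * Real.pi) = 2 ^ n * Real.pi by ring, zero_add] at this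
    rw [this]
    exact (integral_dyadicProd_le hper hp hnn hc hpc n).trans
      (mul_le_mul_of_nonneg_left (hB n) (by positivity))
  calc ∫⁻ ξ, ENNReal.ofReal (P ξ) = ∫⁻ ξ, liminf (fun n => f n ξ) atTop := by simp_rw [hlim]
    _ ≤ liminf (fun n => ∫⁻ ξ, f n ξ) atTop := lintegral_liminf_le fun n =>
        (ENNReal.measurable_ofReal.comp (hcont n).measurable).indicator measurableSet_Ioc
    _ ≤ _ := liminf_le_of_le (by isBoundedDefault) fun b hb => by
        obtain ⟨n, hn⟩ := hb.exists
        exact hn.trans (hint n)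

/-! ### Holomorphic functions on a strip -/

/-- The horizontal strip `|Im z| < δ`. -/
def strip (δ : ℝ) : Set ℂ := {z | |z.im| < δ}

theorem isOpen_strip (δ : ℝ) : IsOpen (strip δ) :=
  isOpen_lt (Complex.continuous_im.abs) continuous_const

theorem ofReal_mem_strip {δ : ℝ} (hδ : 0 < δ) (ξ : ℝ) : (ξ : ℂ) ∈ strip δ := by
  simpa [strip] using hδ

theorem ofReal_add_mem_strip {δ : ℝ} (ξ : ℝ) {w : ℂ} (hw : ‖w‖ < δ) : (ξ : ℂ) + w ∈ strip δ := by
  simpa [strip] using (Complex.abs_im_le_norm w).trans_lt hw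

theorem div_two_pow_mem_strip {δ : ℝ} {z : ℂ} (hz : z ∈ strip δ) (k : ℕ) :
    z / 2 ^ k ∈ strip δ := by
  have : (z / 2 ^ k).im = z.im / 2 ^ k := by
    have := Complex.div_ofReal_im z (2 ^ k); push_cast at this; exact this
  simp only [strip, Set.mem_ofPred_eq, this, abs_div] at *
  refine (div_le_self (abs_nonneg _) ?_).trans_lt hz
  rw [abs_of_pos (by positivity)]
  exact one_le_pow₀ (by norm_num)

theorem hasDerivAt_iteratedDeriv_ofReal {F : ℂ → ℂ} {δ : ℝ} (hδ : 0 < δ)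
    (hF : DifferentiableOn ℂ F (strip δ)) (k : ℕ) (ξ : ℝ) :
    HasDerivAt (fun ξ : ℝ => iteratedDeriv k F ξ) (iteratedDeriv (k + 1) F ξ) ξ := by
  have h : AnalyticAt ℂ F ξ :=
    hF.analyticAt ((isOpen_strip δ).mem_nhds (ofReal_mem_strip hδ ξ))
  rw [iteratedDeriv_succ, iteratedDeriv_eq_iterate]
  exact (h.iterated_deriv k).differentiableAt.hasDerivAt.comp_ofReal

/-- Cauchy's estimate on the circle of radius `δ / 2` about `ξ` bounds the `k`-th derivative by a
constant times `G ξ`. -/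
theorem memLp_iteratedDeriv_of_majorant {F : ℂ → ℂ} {δ : ℝ} (hδ : 0 < δ)
    (hF : DifferentiableOn ℂ F (strip δ)) {G : ℝ → ℝ} (hG : MemLp G 2)
    (hFG : ∀ (ξ : ℝ) (w : ℂ), ‖w‖ < δ → ‖F (ξ + w)‖ ≤ G ξ) (k : ℕ) :
    MemLp (fun ξ : ℝ => iteratedDeriv k F ξ) 2 := by
  refine (hG.const_mul (k.factorial / (δ / 2) ^ k)).mono ?_ (.of_forall fun ξ => ?_)
  · exact (continuous_iff_continuousAt.2 fun ξ =>
      (hasDerivAt_iteratedDeriv_ofReal hδ hF k ξ).continuousAt).aestronglyMeasurable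
  · have h := Complex.norm_iteratedDeriv_le_of_forall_mem_sphere_norm_le (f := F) (c := ξ)
      (R := δ / 2) (C := G ξ) k (by positivity) ?_ ?_
    · refine h.trans ((le_of_eq ?_).trans (le_abs_self _))
      ring
    · refine DifferentiableOn.diffContOnCl (hF.mono fun z hz => ?_)
      have hz' := Metric.closure_ball_subset_closedBall hz
      rw [Metric.mem_closedBall, dist_eq_norm] at hz'
      simpa using ofReal_add_mem_strip (δ := δ) ξ (w := z - ξ) (by linarith)
    · intro z hz
      rw [mem_sphere_iff_norm] at hz
      simpa using hFG ξ (z - ξ) (by linarith)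

theorem summable_const_div_two_pow (C : ℝ) : Summable fun k : ℕ => C / 2 ^ (k + 1) := by
  have := (summable_geometric_two.mul_left (C / 2))
  refine this.congr fun k => ?_
  rw [pow_succ, div_pow, one_pow]; field_simp

theorem tsum_const_div_two_pow (C : ℝ) : ∑' k : ℕ, C / 2 ^ (k + 1) = C := by
  have h : (fun k : ℕ => C / 2 ^ (k + 1)) = fun k : ℕ => C / 2 * (1 / 2) ^ k := by
    ext k; rw [pow_succ, div_pow, one_pow]; field_simp
  rw [h, tsum_mul_left, tsum_geometric_two]; ring

/-! ### Strip symbols and their infinite products -/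

/-- A symbol that is holomorphic and Lipschitz on a strip, and a normalised `2π`-periodic
quadrature mirror filter on the real line. -/
structure IsStripSymbol (M : ℂ → ℂ) (δ C : ℝ) : Prop where
  pos : 0 < δ
  nonneg : 0 ≤ C
  differentiableOn : DifferentiableOn ℂ M (strip δ)
  lipschitz : ∀ z ∈ strip δ, ∀ w ∈ strip δ, ‖M z - M w‖ ≤ C * ‖z - w‖
  periodic : ∀ ξ : ℝ, M ((ξ + 2 * Real.pi : ℝ)) = M ξ
  quadrature : ∀ ξ : ℝ, ‖M ξ‖ ^ 2 + ‖M ((ξ + Real.pi : ℝ))‖ ^ 2 = 1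
  map_zero : M 0 = 1

/-- The infinite product `∏_{k ≥ 1} M(2^{-k} z)`. -/
def cascade (M : ℂ → ℂ) (z : ℂ) : ℂ := ∏' k : ℕ, M (z / 2 ^ (k + 1))

namespace IsStripSymbol

variable {M : ℂ → ℂ} {δ C : ℝ}

theorem norm_sub_one_le (h : IsStripSymbol M δ C) {z : ℂ} (hz : z ∈ strip δ) (k : ℕ) :
    ‖M (z / 2 ^ k) - 1‖ ≤ C * ‖z‖ / 2 ^ k := by
  have := h.lipschitz _ (div_two_pow_mem_strip hz k) 0 (by simpa using ofReal_mem_strip h.pos 0)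
  rw [h.map_zero] at this
  simpa [mul_div_assoc] using this

/-- The Lipschitz bound at `0` makes the deviations of the factors from `1` geometrically summable,
uniformly on compact sets. -/
theorem hasProdLocallyUniformlyOn (h : IsStripSymbol M δ C) :
    HasProdLocallyUniformlyOn (fun (k : ℕ) z => M (z / 2 ^ (k + 1))) (cascade M) (strip δ) := by
  apply hasProdLocallyUniformlyOn_of_forall_compact (isOpen_strip δ)
  intro K hK hcK
  obtain ⟨R, hR⟩ := hcK.isBounded.exists_norm_le
  have := (summable_const_div_two_pow (C * R)).hasProdUniformlyOn_nat_one_add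
    (f := fun (k : ℕ) z => M (z / 2 ^ (k + 1)) - 1) hcK (.of_forall fun n x hx => ?_) fun n => ?_
  · simpa [cascade] using! this
  · refine (h.norm_sub_one_le (hK hx) (n + 1)).trans ?_
    gcongr
    · exact h.nonneg
    · exact hR x hx
  · refine ContinuousOn.sub (h.differentiableOn.continuousOn.comp (by fun_prop) fun z hz => ?_)
      continuousOn_const
    exact div_two_pow_mem_strip (hK hz) _

theorem tendsto_cascade (h : IsStripSymbol M δ C) {z : ℂ} (hz : z ∈ strip δ) :
    Tendsto (fun n => ∏ k ∈ Finset.range n, M (z / 2 ^ (k + 1))) atTop (𝓝 (cascade M z)) :=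
  (h.hasProdLocallyUniformlyOn.hasProd hz).tendsto_prod_nat

theorem differentiableOn_cascade (h : IsStripSymbol M δ C) :
    DifferentiableOn ℂ (cascade M) (strip δ) := by
  refine h.hasProdLocallyUniformlyOn.differentiableOn (.of_forall fun s => ?_) (isOpen_strip δ)
  refine DifferentiableOn.fun_finsetProd fun k _ => ?_
  exact h.differentiableOn.comp (by fun_prop) fun z hz => div_two_pow_mem_strip hz _

theorem cascade_zero (h : IsStripSymbol M δ C) : cascade M 0 = 1 := by
  simp [cascade, h.map_zero]

theorem cascade_eq (h : IsStripSymbol M δ C) {z : ℂ} (hz : z ∈ strip δ) :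
    cascade M z = M (z / 2) * cascade M (z / 2) := by
  have h1 := (tendsto_add_atTop_iff_nat 1).2 (h.tendsto_cascade hz)
  have hz2 : z / 2 ∈ strip δ := by simpa using div_two_pow_mem_strip hz 1
  have h2 := (h.tendsto_cascade hz2).const_mul (M (z / 2))
  refine tendsto_nhds_unique h1 (h2.congr fun n => ?_)
  rw [Finset.prod_range_succ', mul_comm]
  simp only [zero_add, pow_one]
  congr 1
  refine Finset.prod_congr rfl fun k _ => ?_
  rw [pow_succ' _ (k + 1), div_div]

theorem norm_le_one (h : IsStripSymbol M δ C) (ξ : ℝ) : ‖M ξ‖ ≤ 1 := by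
  have := h.quadrature ξ
  nlinarith [norm_nonneg (M ξ), sq_nonneg ‖M ((ξ + Real.pi : ℝ))‖]

theorem continuous_ofReal (h : IsStripSymbol M δ C) : Continuous fun ξ : ℝ => M ξ :=
  continuous_iff_continuousAt.2 fun ξ =>
    ((h.differentiableOn.differentiableAt
      ((isOpen_strip δ).mem_nhds (ofReal_mem_strip h.pos ξ))).continuousAt).comp
      (f := fun ξ : ℝ => (ξ : ℂ)) (by fun_prop)

/-- For `|w| < δ` the `k`-th factor at `ξ + w` has modulus at most that at `ξ` plus `e k`. The
product of these enlarged real factors is `G`; the dyadic bound applies to its square. -/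
theorem exists_majorant (h : IsStripSymbol M δ C) :
    ∃ G : ℝ → ℝ, MemLp G 2 ∧ ∀ (ξ : ℝ) (w : ℂ), ‖w‖ < δ → ‖cascade M (ξ + w)‖ ≤ G ξ := by
  set e : ℕ → ℝ := fun k => C * δ / 2 ^ (k + 1) with he
  have hC := h.nonneg
  have hδ := h.pos
  have he0 (k) : 0 ≤ e k := by positivity
  have hes : Summable e := summable_const_div_two_pow _
  set g : ℕ → ℝ → ℝ := fun k t => ‖M t‖ + e k with hg
  have hgc (k) : Continuous (g k) := h.continuous_ofReal.norm.add continuous_const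
  have hg0 (k t) : 0 ≤ g k t := add_nonneg (norm_nonneg _) (he0 k)
  set G : ℝ → ℝ := fun ξ => ∏' k, g k (ξ / 2 ^ (k + 1)) with hG
  have hlim (ξ) : Tendsto (fun n => dyadicProd g n ξ) atTop (𝓝 (G ξ)) := by
    have hm : Multipliable fun k => 1 + (g k (ξ / 2 ^ (k + 1)) - 1) := by
      apply multipliable_one_add_of_summable
      refine Summable.of_nonneg_of_le (fun _ => norm_nonneg _) (fun k => ?_)
        ((summable_const_div_two_pow (C * |ξ|)).add hes)
      have h1 := h.norm_sub_one_le (ofReal_mem_strip hδ ξ) (k + 1)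
      have h2 := abs_norm_sub_norm_le (M ((ξ : ℂ) / 2 ^ (k + 1))) 1
      rw [norm_one] at h2
      have h3 : g k (ξ / 2 ^ (k + 1)) - 1 = (‖M ((ξ : ℂ) / 2 ^ (k + 1))‖ - 1) + e k := by
        simp only [hg]; push_cast; ring
      rw [h3]
      refine (norm_add_le _ _).trans (add_le_add ?_ ?_)
      · rw [Real.norm_eq_abs]
        simpa using h2.trans h1
      · rw [Real.norm_of_nonneg (he0 k)]
    simp only [add_sub_cancel] at hm
    exact hm.hasProd.tendsto_prod_nat
  have hGm : Measurable G :=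
    measurable_of_tendsto_metrizable (fun n => (continuous_dyadicProd hgc n).measurable)
      (tendsto_pi_nhds.2 hlim)
  refine ⟨G, ?_, fun ξ w hw => ?_⟩
  · rw [memLp_two_iff_integrable_sq hGm.aestronglyMeasurable]
    refine ⟨(hGm.pow_const 2).aestronglyMeasurable, ?_⟩
    rw [hasFiniteIntegral_iff_ofReal (.of_forall fun ξ => sq_nonneg _)]
    -- By the quadrature identity the two enlarged squares add up to at most `1 + 4e + 2e² ≤ (1 +
    -- 2e)² ≤ exp(4e)`, and the `e k` sum to `C * δ`; hence `c` and `B`.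
    refine (lintegral_ofReal_le_of_tendsto_dyadicProd (p := fun k t => g k t ^ 2)
      (c := fun k => (1 + 2 * e k) ^ 2) (B := Real.exp (4 * (C * δ))) ?_ ?_ ?_ ?_ ?_ ?_ ?_).trans_lt
        ENNReal.ofReal_lt_top
    · intro k t
      simp only [hg, h.periodic t]
    · exact fun k => (hgc k).pow 2
    · exact fun k t => sq_nonneg _
    · exact fun k => sq_nonneg _
    · intro k t
      have q := h.quadrature t
      have a1 := h.norm_le_one t
      have a2 := h.norm_le_one (t + Real.pi)
      simp only [hg]
      nlinarith [mul_le_mul_of_nonneg_right a1 (he0 k), mul_le_mul_of_nonneg_right a2 (he0 k),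
        sq_nonneg (e k)]
    · intro n
      have h1 (k) : (1 + 2 * e k) ^ 2 ≤ Real.exp (4 * e k) := by
        have := Real.add_one_le_exp (2 * e k)
        calc (1 + 2 * e k) ^ 2 ≤ (Real.exp (2 * e k)) ^ 2 :=
              pow_le_pow_left₀ (by have := he0 k; positivity) (by linarith) 2
          _ = _ := by rw [← Real.exp_nat_mul]; congr 1; push_cast; ring
      refine (Finset.prod_le_prod (fun _ _ => sq_nonneg _) fun k _ => h1 k).trans ?_
      rw [← Real.exp_sum, Real.exp_le_exp, ← Finset.mul_sum]
      have := hes.sum_le_tsum (Finset.range n) fun k _ => he0 k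
      rw [he, tsum_const_div_two_pow] at this
      linarith
    · intro ξ
      refine ((hlim ξ).pow 2).congr fun n => ?_
      simp [dyadicProd, Finset.prod_pow]
  · refine le_of_tendsto_of_tendsto'
      ((h.tendsto_cascade (ofReal_add_mem_strip ξ hw)).norm) (hlim ξ) fun n => ?_
    rw [norm_prod]
    refine Finset.prod_le_prod (fun _ _ => norm_nonneg _) fun k _ => ?_
    have h1 := h.lipschitz _ (div_two_pow_mem_strip (ofReal_add_mem_strip ξ hw) (k + 1)) _
      (div_two_pow_mem_strip (ofReal_mem_strip hδ ξ) (k + 1))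
    have h2 : ((ξ : ℂ) + w) / 2 ^ (k + 1) - ξ / 2 ^ (k + 1) = w / 2 ^ (k + 1) := by ring
    rw [h2, norm_div, norm_pow, Complex.norm_ofNat] at h1
    have h3 : C * (‖w‖ / 2 ^ (k + 1)) ≤ e k := by
      simp only [he]
      rw [← mul_div_assoc]
      gcongr
    have h4 := norm_sub_norm_le (M (((ξ : ℂ) + w) / 2 ^ (k + 1))) (M (ξ / 2 ^ (k + 1)))
    simp only [hg]
    push_cast
    linarith

end IsStripSymbol

/-! ### The filter on the unit circle and its extension to a strip -/

open Filter Topology Polynomial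

theorem comp_eq (f g : RatFunc ℝ) :
    comp f g = f.num.eval₂ RatFunc.C g / f.denom.eval₂ RatFunc.C g := rfl

theorem eval₂_C_neg_X (p : ℝ[X]) :
    p.eval₂ RatFunc.C (-RatFunc.X) = algebraMap ℝ[X] (RatFunc ℝ) (p.comp (-X)) := by
  rw [Polynomial.comp, Polynomial.hom_eval₂, map_neg, RatFunc.algebraMap_X,
    RatFunc.algebraMap_comp_C]

theorem comp_neg_X (H : RatFunc ℝ) : comp H (-RatFunc.X) =
    algebraMap ℝ[X] (RatFunc ℝ) (H.num.comp (-X)) /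
      algebraMap ℝ[X] (RatFunc ℝ) (H.denom.comp (-X)) := by
  rw [comp_eq, eval₂_C_neg_X, eval₂_C_neg_X]

theorem comp_neg_X_ne_zero {p : ℝ[X]} (hp : p ≠ 0) : p.comp (-X) ≠ 0 := by
  intro h
  have := congrArg (fun q => q.comp (-X)) h
  simp only [Polynomial.comp_assoc, Polynomial.neg_comp, Polynomial.X_comp, neg_neg,
    Polynomial.comp_X, Polynomial.zero_comp] at this
  exact hp this

theorem num_denom_quadrature {H : RatFunc ℝ} (hH : IsZeroSymFilter H) :
    H.num ^ 2 * (H.denom.comp (-X)) ^ 2 + (H.num.comp (-X)) ^ 2 * H.denom ^ 2 =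
      H.denom ^ 2 * (H.denom.comp (-X)) ^ 2 := by
  have hd := RatFunc.algebraMap_ne_zero H.denom_ne_zero
  have hd' := RatFunc.algebraMap_ne_zero (comp_neg_X_ne_zero H.denom_ne_zero)
  have h := hH.1
  rw [comp_neg_X] at h
  nth_rewrite 1 [← RatFunc.num_div_denom H] at h
  field_simp at h
  apply RatFunc.algebraMap_injective ℝ
  simp only [map_add, map_mul, map_pow]
  linear_combination h

/-- `conj (p(z)) d(z) = p(z) conj (d(z))` on the unit circle. -/
theorem conj_num_mul_denom {H : RatFunc ℝ} (hH : IsZeroSymFilter H) {z : ℂ} (hz : ‖z‖ = 1) :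
    conj (aeval z H.num) * aeval z H.denom = aeval z H.num * conj (aeval z H.denom) := by
  set N := max H.num.natDegree H.denom.natDegree
  have hX : (RatFunc.X : RatFunc ℝ) ≠ 0 := RatFunc.X_ne_zero
  have hz0 : z ≠ 0 := by rintro rfl; simp at hz
  -- Reversal of coefficients clears the negative powers in `p(X⁻¹)`; on the unit circle `z⁻¹ = conj
  -- z` (`key2`), so `H(z⁻¹) = H(z)` becomes a statement about conjugates.
  have key (p : ℝ[X]) (hp : p.natDegree ≤ N) : p.eval₂ RatFunc.C (RatFunc.X⁻¹) * RatFunc.X ^ N =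
      algebraMap ℝ[X] (RatFunc ℝ) (p.reflect N) := by
    let _ := invertibleOfNonzero hX
    have := Polynomial.eval₂_reflect_mul_pow RatFunc.C RatFunc.X N (p.reflect N)
      (Polynomial.natDegree_reflect_le.trans (by simp [hp]))
    rw [Polynomial.reflect_reflect, invOf_eq_inv] at this
    rw [this, ← RatFunc.algebraMap_X, ← RatFunc.algebraMap_comp_C, ← Polynomial.hom_eval₂]
    simp
  have key2 (p : ℝ[X]) (hp : p.natDegree ≤ N) : aeval z (p.reflect N) = z ^ N * conj (aeval z p) := by
    let _ := invertibleOfNonzero hz0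
    have := Polynomial.eval₂_reflect_mul_pow (algebraMap ℝ ℂ) z N (p.reflect N)
      (Polynomial.natDegree_reflect_le.trans (by simp [hp]))
    rw [Polynomial.reflect_reflect, invOf_eq_inv, Complex.inv_eq_conj hz] at this
    rw [← Polynomial.aeval_conj, mul_comm]
    exact this.symm
  have hd := RatFunc.algebraMap_ne_zero H.denom_ne_zero
  have hd' : H.denom.eval₂ RatFunc.C (RatFunc.X⁻¹) ≠ 0 := by
    intro h
    have := key H.denom (le_max_right _ _)
    rw [h, zero_mul, eq_comm, map_eq_zero_iff _ (RatFunc.algebraMap_injective ℝ),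
      Polynomial.reflect_eq_zero_iff] at this
    exact H.denom_ne_zero this
  have h := hH.2
  rw [comp_eq] at h
  nth_rewrite 3 [← RatFunc.num_div_denom H] at h
  rw [div_eq_div_iff hd' hd] at h
  have h2 : H.num.reflect N * H.denom = H.num * H.denom.reflect N := by
    apply RatFunc.algebraMap_injective ℝ
    rw [map_mul, map_mul, ← key _ (le_max_left _ _), ← key _ (le_max_right _ _)]
    linear_combination RatFunc.X ^ N * h
  have h3 := congrArg (aeval z) h2
  rw [map_mul, map_mul, key2 _ (le_max_left _ _), key2 _ (le_max_right _ _)] at h3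
  apply mul_left_cancel₀ (pow_ne_zero N hz0)
  linear_combination h3

/-- Away from zeros of the denominators, `H(z)` and `H(-z)` are real with squares summing to `1`.
The inequality extends to the remaining points of the circle by continuity. -/
theorem norm_num_le_norm_denom {H : RatFunc ℝ} (hH : IsZeroSymFilter H) {z : ℂ} (hz : ‖z‖ = 1) :
    ‖aeval z H.num‖ ≤ ‖aeval z H.denom‖ := by
  have hne (w : ℂ) (hw : ‖w‖ = 1) (h : aeval w (H.denom * H.denom.comp (-X)) ≠ 0) :
      ‖aeval w H.num‖ ≤ ‖aeval w H.denom‖ := by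
    have hq := congrArg (aeval w) (num_denom_quadrature hH)
    simp only [map_add, map_mul, map_pow, Polynomial.aeval_comp, map_neg, Polynomial.aeval_X,
      ne_eq, mul_eq_zero, not_or] at hq h
    obtain ⟨h1, h2⟩ := h
    obtain ⟨x, hx⟩ := Complex.conj_eq_iff_real.1 (show conj (aeval w H.num / aeval w H.denom) =
        aeval w H.num / aeval w H.denom by
      rw [map_div₀, div_eq_div_iff (by simpa using h1) h1]
      exact conj_num_mul_denom hH hw)
    obtain ⟨y, hy⟩ := Complex.conj_eq_iff_real.1
        (show conj (aeval (-w) H.num / aeval (-w) H.denom) =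
          aeval (-w) H.num / aeval (-w) H.denom by
      rw [map_div₀, div_eq_div_iff (by simpa using h2) h2]
      exact conj_num_mul_denom hH (by rwa [norm_neg]))
    have hxy : x ^ 2 + y ^ 2 = 1 := by
      have : (x : ℂ) ^ 2 + (y : ℂ) ^ 2 = 1 := by
        rw [← hx, ← hy]
        field_simp
        linear_combination hq
      exact_mod_cast this
    have hx1 : |x| ≤ 1 := abs_le_one_iff_mul_self_le_one.2 (by nlinarith [sq_nonneg y])
    rw [div_eq_iff h1] at hx
    rw [hx, norm_mul, Complex.norm_real]
    exact mul_le_of_le_one_left (norm_nonneg _) hx1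
  have hz0 : z ≠ 0 := by rintro rfl; simp at hz
  have hP : H.denom * H.denom.comp (-X) ≠ 0 :=
    mul_ne_zero H.denom_ne_zero (comp_neg_X_ne_zero H.denom_ne_zero)
  -- Approach `z` along the circle: the nonzero derivative keeps the curve off `z` for small `s ≠
  -- 0`, so it avoids the finitely many bad points.
  have hder : HasDerivAt (fun s : ℝ => z * Complex.exp (s * Complex.I)) (z * Complex.I) 0 := by
    have h1 : HasDerivAt (fun s : ℂ => z * Complex.exp (s * Complex.I)) (z * Complex.I)
        ((0 : ℝ) : ℂ) := by
      simpa using (((hasDerivAt_id (0 : ℂ)).mul_const Complex.I).cexp).const_mul z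
    exact h1.comp_ofReal
  have ht := hder.tendsto_nhdsNE (mul_ne_zero hz0 Complex.I_ne_zero)
  simp only [Complex.ofReal_zero, zero_mul, Complex.exp_zero, mul_one] at ht
  have hev : ∀ᶠ w in 𝓝[≠] z, aeval w (H.denom * H.denom.comp (-X)) ≠ 0 := by
    have hfin := ((H.denom * H.denom.comp (-X)).rootSet_finite ℂ).subset
      (Set.sdiff_subset (t := {z}))
    filter_upwards [nhdsWithin_le_nhds (hfin.isClosed.isOpen_compl.mem_nhds (by simp)),
      self_mem_nhdsWithin] with w hw1 hw2 hw3
    exact hw1 ⟨(Polynomial.mem_rootSet_of_ne hP).2 hw3, hw2⟩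
  have hle : ∀ᶠ s : ℝ in 𝓝[≠] 0, ‖aeval (z * Complex.exp (s * Complex.I)) H.num‖ ≤
      ‖aeval (z * Complex.exp (s * Complex.I)) H.denom‖ :=
    (ht.eventually hev).mono fun s hs => hne _ (by simp [hz, Complex.norm_exp_ofReal_mul_I]) hs
  have htz := ht.mono_right nhdsWithin_le_nhds
  exact le_of_tendsto_of_tendsto ((H.num.continuous_aeval.tendsto z).comp htz).norm
    ((H.denom.continuous_aeval.tendsto z).comp htz).norm hle

/-- By the norm inequality a zero of the denominator on the circle is also one of the numerator,
against coprimality. -/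
theorem aeval_denom_ne_zero {H : RatFunc ℝ} (hH : IsZeroSymFilter H) {z : ℂ} (hz : ‖z‖ = 1) :
    aeval z H.denom ≠ 0 := by
  intro h
  have h1 : aeval z H.num = 0 := by
    simpa [h] using norm_num_le_norm_denom hH hz
  obtain ⟨a, b, hab⟩ := RatFunc.isCoprime_num_denom H
  have := congrArg (aeval z) hab
  simp [h, h1] at this

/-- The frequency response `z ↦ H(e^{-iz})` in the complex plane. -/
def complexResponse (H : RatFunc ℝ) (z : ℂ) : ℂ :=
  RatFunc.eval (algebraMap ℝ ℂ) (Complex.exp (-Complex.I * z)) H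

theorem complexResponse_eq (H : RatFunc ℝ) (z : ℂ) : complexResponse H z =
    aeval (Complex.exp (-Complex.I * z)) H.num / aeval (Complex.exp (-Complex.I * z)) H.denom := rfl

theorem norm_exp_neg_I_mul_ofReal (ξ : ℝ) : ‖Complex.exp (-Complex.I * ξ)‖ = 1 := by
  simp [Complex.norm_exp]

theorem conj_complexResponse {H : RatFunc ℝ} (hH : IsZeroSymFilter H) (ξ : ℝ) :
    conj (complexResponse H ξ) = complexResponse H ξ := by
  have hz := norm_exp_neg_I_mul_ofReal ξ
  have hd := aeval_denom_ne_zero hH hz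
  rw [complexResponse_eq, map_div₀, div_eq_div_iff (by simpa using hd) hd]
  exact conj_num_mul_denom hH hz

theorem complexResponse_sq_add_sq {H : RatFunc ℝ} (hH : IsZeroSymFilter H) (ξ : ℝ) :
    complexResponse H ξ ^ 2 + complexResponse H ((ξ + Real.pi : ℝ)) ^ 2 = 1 := by
  have e : Complex.exp (-Complex.I * ((ξ + Real.pi : ℝ))) = -Complex.exp (-Complex.I * ξ) := by
    push_cast
    rw [mul_add, Complex.exp_add, neg_mul, neg_mul, Complex.exp_neg (Complex.I * Real.pi), mul_comm Complex.I Real.pi,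
      Complex.exp_pi_mul_I]
    simp
  have hd := aeval_denom_ne_zero hH (norm_exp_neg_I_mul_ofReal ξ)
  have hd' := aeval_denom_ne_zero hH (norm_exp_neg_I_mul_ofReal (ξ + Real.pi))
  rw [complexResponse_eq, complexResponse_eq]
  rw [e] at hd' ⊢
  generalize Complex.exp (-Complex.I * ξ) = w at *
  have := congrArg (aeval w) (num_denom_quadrature hH)
  simp only [map_add, map_mul, map_pow, Polynomial.aeval_comp, map_neg, Polynomial.aeval_X] at this
  field_simp
  linear_combination this

theorem exp_neg_I_mul_add_two_pi (z : ℂ) (n : ℤ) :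
    Complex.exp (-Complex.I * (z + n * (2 * Real.pi))) = Complex.exp (-Complex.I * z) := by
  rw [show -Complex.I * (z + n * (2 * Real.pi)) = -Complex.I * z - n * (2 * Real.pi * Complex.I) by
    ring]
  exact Complex.exp_periodic.sub_int_mul_eq n

theorem exp_neg_I_mul_add_pi (z : ℂ) :
    Complex.exp (-Complex.I * (z + Real.pi)) = -Complex.exp (-Complex.I * z) := by
  rw [show -Complex.I * (z + Real.pi) = -Complex.I * z - Real.pi * Complex.I by ring]
  exact Complex.exp_sub_pi_mul_I _

theorem complexResponse_add_int_mul (H : RatFunc ℝ) (z : ℂ) (n : ℤ) :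
    complexResponse H (z + n * (2 * Real.pi)) = complexResponse H z := by
  simp only [complexResponse, exp_neg_I_mul_add_two_pi]

theorem isNormalized_iff {H : RatFunc ℝ} : IsNormalized H ↔
    H.num.eval 1 / H.denom.eval 1 = 1 := by
  rw [IsNormalized, RatFunc.eval, Polynomial.eval₂_id, Polynomial.eval₂_id]

theorem complexResponse_zero {H : RatFunc ℝ} (hn : IsNormalized H) : complexResponse H 0 = 1 := by
  rw [isNormalized_iff] at hn
  have h (p : ℝ[X]) : aeval (1 : ℂ) p = (p.eval 1 : ℝ) := by
    simpa using Polynomial.aeval_algebraMap_apply ℂ (1 : ℝ) p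
  rw [complexResponse_eq, mul_zero, Complex.exp_zero, h, h, ← Complex.ofReal_div, hn,
    Complex.ofReal_one]

theorem isOpen_aeval_exp_ne_zero (p : ℝ[X]) :
    IsOpen {z : ℂ | aeval (Complex.exp (-Complex.I * z)) p ≠ 0} :=
  isOpen_ne_fun (p.continuous_aeval.comp (by fun_prop)) continuous_const

theorem differentiable_aeval_exp (p : ℝ[X]) :
    Differentiable ℂ fun z : ℂ => aeval (Complex.exp (-Complex.I * z)) p :=
  p.differentiable_aeval.comp
    (f := fun z : ℂ => Complex.exp (-Complex.I * z)) (by fun_prop)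

theorem differentiableAt_complexResponse {H : RatFunc ℝ} {z : ℂ}
    (hz : aeval (Complex.exp (-Complex.I * z)) H.denom ≠ 0) :
    DifferentiableAt ℂ (complexResponse H) z :=
  (differentiable_aeval_exp _ z).fun_div (differentiable_aeval_exp _ z) hz

/-- A compact neighbourhood of one real period avoids the poles and bounds the derivative.
Periodicity spreads this over a strip, whose convexity gives the Lipschitz bound. -/
theorem exists_isStripSymbol {H : RatFunc ℝ} (hH : IsZeroSymFilter H) (hn : IsNormalized H) :
    ∃ δ C, IsStripSymbol (complexResponse H) δ C := by
  set U : Set ℂ := {z : ℂ | aeval (Complex.exp (-Complex.I * z)) H.denom ≠ 0} with hU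
  have hUo : IsOpen U := isOpen_aeval_exp_ne_zero _
  have hdiff : DifferentiableOn ℂ (complexResponse H) U := fun z hz =>
    (differentiableAt_complexResponse hz).differentiableWithinAt
  set K : Set ℂ := Complex.ofReal '' Set.Icc 0 (2 * Real.pi) with hK
  have hKc : IsCompact K := isCompact_Icc.image Complex.continuous_ofReal
  have hKU : K ⊆ U := by
    rintro _ ⟨ξ, -, rfl⟩
    exact aeval_denom_ne_zero hH (norm_exp_neg_I_mul_ofReal ξ)
  obtain ⟨δ, hδ, hδU⟩ := hKc.exists_cthickening_subset_open hUo hKU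
  obtain ⟨C, hC⟩ := (hKc.cthickening (r := δ)).exists_bound_of_continuousOn
    ((hdiff.deriv hUo).continuousOn.mono hδU)
  have htrans (z : ℂ) (hz : z ∈ strip δ) :
      ∃ n : ℤ, z + n * (2 * Real.pi) ∈ Metric.cthickening δ K := by
    obtain ⟨n, hn, -⟩ := existsUnique_add_zsmul_mem_Ico (by positivity : 0 < 2 * Real.pi) z.re 0
    refine ⟨n, Metric.mem_cthickening_of_dist_le _ ((z.re + n • (2 * Real.pi) : ℝ) : ℂ) _ _
      ⟨_, ⟨hn.1, by simpa using hn.2.le⟩, rfl⟩ ?_⟩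
    have : z + n * (2 * Real.pi) - ((z.re + n • (2 * Real.pi) : ℝ) : ℂ) = z.im * Complex.I := by
      nth_rewrite 1 [← Complex.re_add_im z]
      push_cast [zsmul_eq_mul]; ring
    rw [dist_eq_norm, this]
    simpa using hz.le
  have hper (n : ℤ) : (fun z => complexResponse H (z + n * (2 * Real.pi))) = complexResponse H :=
    funext fun z => complexResponse_add_int_mul H z n
  have hsU (z : ℂ) (hz : z ∈ strip δ) : z ∈ U := by
    obtain ⟨n, hn⟩ := htrans z hz
    have := hδU hn
    simpa only [hU, Set.mem_ofPred_eq, exp_neg_I_mul_add_two_pi] using this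
  have hder (z : ℂ) (hz : z ∈ strip δ) : ‖deriv (complexResponse H) z‖ ≤ C := by
    obtain ⟨n, hn⟩ := htrans z hz
    rw [← hper n, deriv_comp_add_const]
    exact hC _ hn
  have hconv : Convex ℝ (strip δ) := by
    have : strip δ = Complex.imLm ⁻¹' (Set.Ioo (-δ) δ) := by
      ext z; simp [strip, abs_lt]
    rw [this]
    exact (convex_Ioo _ _).linear_preimage _
  refine ⟨δ, C, hδ, (norm_nonneg _).trans (hder 0 (by simpa using ofReal_mem_strip hδ 0)),
    hdiff.mono hsU, fun z hz w hw => ?_, fun ξ => ?_, fun ξ => ?_, complexResponse_zero hn⟩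
  · exact hconv.norm_image_sub_le_of_norm_deriv_le
      (fun x hx => differentiableAt_complexResponse (hsU x hx)) hder hw hz
  · simpa using complexResponse_add_int_mul H ξ 1
  · have h := complexResponse_sq_add_sq hH ξ
    -- Values on the real line are real, so their squares are squared norms.
    have hr (ξ : ℝ) : complexResponse H ξ ^ 2 = ((‖complexResponse H ξ‖ ^ 2 : ℝ) : ℂ) := by
      rw [Complex.ofReal_pow, ← Complex.mul_conj', conj_complexResponse hH, sq]
    rw [hr, hr] at h
    exact_mod_cast h

/-! ### Orders of vanishing in the frequency variable -/

theorem le_analyticOrderAt_aeval_exp {p : ℝ[X]} {N : ℕ} {c : ℝ} {z₀ : ℂ}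
    (hp : (X - Polynomial.C c) ^ N ∣ p) (hz : Complex.exp (-Complex.I * z₀) = c) :
    N ≤ analyticOrderAt (fun z : ℂ => aeval (Complex.exp (-Complex.I * z)) p) z₀ := by
  obtain ⟨q, rfl⟩ := hp
  have ha (r : ℝ[X]) : AnalyticAt ℂ (fun z : ℂ => aeval (Complex.exp (-Complex.I * z)) r) z₀ :=
    (differentiable_aeval_exp r).analyticAt z₀
  have e : (fun z : ℂ => aeval (Complex.exp (-Complex.I * z)) ((X - Polynomial.C c) ^ N * q)) =
      (fun z : ℂ => aeval (Complex.exp (-Complex.I * z)) (X - Polynomial.C c)) ^ N *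
        (fun z : ℂ => aeval (Complex.exp (-Complex.I * z)) q) := by
    ext z; simp
  rw [e, analyticOrderAt_mul ((ha _).pow N) (ha q), analyticOrderAt_pow (ha _)]
  have h1 : 1 ≤ analyticOrderAt
      (fun z : ℂ => aeval (Complex.exp (-Complex.I * z)) (X - Polynomial.C c)) z₀ := by
    rw [Order.one_le_iff_ne_zero, (ha _).analyticOrderAt_ne_zero]
    rw [map_sub, Polynomial.aeval_X, Polynomial.aeval_C, hz]; simp
  calc (N : ℕ∞) = N • 1 := by simp
    _ ≤ N • analyticOrderAt
      (fun z : ℂ => aeval (Complex.exp (-Complex.I * z)) (X - Polynomial.C c)) z₀ :=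
        nsmul_le_nsmul_right h1 N
    _ ≤ _ := le_self_add

theorem le_analyticOrderAt_complexResponse_sub_one {H : RatFunc ℝ} (hH : IsZeroSymFilter H)
    {N : ℕ} (h : (X - Polynomial.C 1) ^ N ∣ H.denom - H.num) :
    N ≤ analyticOrderAt (fun z => complexResponse H z - 1) 0 := by
  have hd : aeval (Complex.exp (-Complex.I * 0)) H.denom ≠ 0 :=
    aeval_denom_ne_zero hH (by simp)
  have ha (p : ℝ[X]) : AnalyticAt ℂ (fun z : ℂ => aeval (Complex.exp (-Complex.I * z)) p) 0 :=
    (differentiable_aeval_exp p).analyticAt 0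
  have e : (fun z => complexResponse H z - 1) =ᶠ[𝓝 0]
      (fun z : ℂ => aeval (Complex.exp (-Complex.I * z)) (H.denom - H.num)) *
        (fun z : ℂ => -(aeval (Complex.exp (-Complex.I * z)) H.denom)⁻¹) := by
    filter_upwards [(isOpen_aeval_exp_ne_zero H.denom).mem_nhds hd] with z hz
    have hz : aeval (Complex.exp (-Complex.I * z)) H.denom ≠ 0 := hz
    rw [complexResponse_eq, Pi.mul_apply, map_sub]
    generalize Complex.exp (-Complex.I * z) = w at *
    field_simp
    ring
  rw [analyticOrderAt_congr e, analyticOrderAt_mul (ha _) ((ha _).fun_inv hd).fun_neg]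
  exact (le_analyticOrderAt_aeval_exp (c := 1) h (by simp)).trans le_self_add

theorem le_analyticOrderAt_complexResponse_add_pi {H : RatFunc ℝ} (hH : IsZeroSymFilter H)
    {N : ℕ} (h : (X - Polynomial.C (-1)) ^ N ∣ H.num) :
    N ≤ analyticOrderAt (fun z => complexResponse H (z + Real.pi)) 0 := by
  have e0 : Complex.exp (-Complex.I * Real.pi) = -1 := by
    simpa using exp_neg_I_mul_add_pi 0
  have hd : aeval (Complex.exp (-Complex.I * Real.pi)) H.denom ≠ 0 :=
    aeval_denom_ne_zero hH (by rw [e0]; simp)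
  have ha (p : ℝ[X]) :
      AnalyticAt ℂ (fun z : ℂ => aeval (Complex.exp (-Complex.I * z)) p) Real.pi :=
    (differentiable_aeval_exp p).analyticAt _
  have h1 : N ≤ analyticOrderAt (complexResponse H) Real.pi := by
    have e : complexResponse H =
        (fun z : ℂ => aeval (Complex.exp (-Complex.I * z)) H.num) *
        (fun z : ℂ => (aeval (Complex.exp (-Complex.I * z)) H.denom)⁻¹) := by
      ext z
      rw [complexResponse_eq, Pi.mul_apply, div_eq_mul_inv]
    rw [e, analyticOrderAt_mul (ha _) ((ha _).fun_inv hd)]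
    exact (le_analyticOrderAt_aeval_exp (c := -1) h (by rw [e0]; simp)).trans le_self_add
  have h2 := analyticOrderAt_comp_of_deriv_ne_zero (f := complexResponse H)
    (g := fun z : ℂ => z + Real.pi) (z₀ := 0) (by fun_prop) (by simp)
  simp only [zero_add] at h2
  exact h1.trans h2.ge

theorem iteratedDeriv_comp_mul_left (f : ℂ → ℂ) (c : ℂ) (k : ℕ) (z : ℂ) :
    iteratedDeriv k (fun z => f (c * z)) z = c ^ k * iteratedDeriv k f (c * z) := by
  induction k generalizing z with
  | zero => simp
  | succ k ih =>
    rw [iteratedDeriv_succ, funext ih, deriv_const_mul_field,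
      deriv_comp_mul_left c (iteratedDeriv k f) z, iteratedDeriv_succ, smul_eq_mul]
    ring

/-- Compare Taylor coefficients in `Φ(2z) - Φ(z) = (M(z) - 1)Φ(z)`: the left side multiplies the
`k`-th derivative at `0` by `2ᵏ - 1`, nonzero for `k ≠ 0`. -/
theorem IsStripSymbol.iteratedDeriv_cascade_zero {M : ℂ → ℂ} {δ C : ℝ} (h : IsStripSymbol M δ C)
    {N : ℕ} (hN : N ≤ analyticOrderAt (fun z => M z - 1) 0) {k : ℕ} (hk0 : k ≠ 0) (hk : k < N) :
    iteratedDeriv k (cascade M) 0 = 0 := by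
  have h0 : (strip δ) ∈ 𝓝 (0 : ℂ) :=
    (isOpen_strip δ).mem_nhds (by simpa using ofReal_mem_strip h.pos 0)
  have haM : AnalyticAt ℂ M 0 := h.differentiableOn.analyticAt h0
  have ha : AnalyticAt ℂ (cascade M) 0 := h.differentiableOn_cascade.analyticAt h0
  have ha2 : AnalyticAt ℂ (fun z => cascade M (2 * z)) 0 :=
    AnalyticAt.fun_comp (by simpa using ha) (by fun_prop)
  have hfac : (fun z => cascade M (2 * z) - cascade M z) =ᶠ[𝓝 0]
      (fun z => M z - 1) * cascade M := by
    have hcont : Tendsto (fun z : ℂ => 2 * z) (𝓝 0) (𝓝 0) :=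
      Continuous.tendsto' (by fun_prop) _ _ (by simp)
    filter_upwards [hcont.eventually h0] with z hz
    rw [h.cascade_eq hz, mul_div_cancel_left₀ _ two_ne_zero]
    simp only [Pi.mul_apply]; ring
  have hord : N ≤ analyticOrderAt (fun z => cascade M (2 * z) - cascade M z) 0 := by
    rw [analyticOrderAt_congr hfac, analyticOrderAt_mul (haM.fun_sub analyticAt_const) ha]
    exact hN.trans le_self_add
  have := (natCast_le_analyticOrderAt_iff_iteratedDeriv_eq_zero (ha2.fun_sub ha)).1 hord k hk
  rw [iteratedDeriv_fun_sub ha2.contDiffAt ha.contDiffAt, iteratedDeriv_comp_mul_left, mul_zero,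
    ← sub_one_mul, mul_eq_zero] at this
  refine this.resolve_left (sub_ne_zero.2 ?_)
  exact_mod_cast (Nat.one_lt_two_pow hk0).ne'

/-! ### Substitution of rational functions and the correspondence -/

theorem eval₂_C_ne_zero {g : RatFunc ℝ} (hg : Transcendental ℝ g) {p : ℝ[X]} (hp : p ≠ 0) :
    p.eval₂ RatFunc.C g ≠ 0 := by
  intro h
  refine hp (transcendental_iff.1 hg p ?_)
  rwa [Polynomial.aeval_def, RatFunc.algebraMap_eq_C]

theorem nonZeroDivisors_le_comap_eval₂ {g : RatFunc ℝ} (hg : Transcendental ℝ g) :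
    nonZeroDivisors ℝ[X] ≤
      (nonZeroDivisors (RatFunc ℝ)).comap (Polynomial.eval₂RingHom RatFunc.C g) := fun _ hp =>
  mem_nonZeroDivisors_of_ne_zero (eval₂_C_ne_zero hg (nonZeroDivisors.ne_zero hp))

/-- Substitution of a transcendental element as a ring homomorphism. -/
def compHom (g : RatFunc ℝ) (hg : Transcendental ℝ g) : RatFunc ℝ →+* RatFunc ℝ :=
  RatFunc.liftRingHom (Polynomial.eval₂RingHom RatFunc.C g) (nonZeroDivisors_le_comap_eval₂ hg)

theorem compHom_apply {g : RatFunc ℝ} (hg : Transcendental ℝ g) (f : RatFunc ℝ) :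
    compHom g hg f = comp f g := by
  rw [comp_eq]
  conv_lhs => rw [← RatFunc.num_div_denom f]
  rw [map_div₀, compHom, RatFunc.liftRingHom_algebraMap, RatFunc.liftRingHom_algebraMap]
  rfl

theorem compHom_C {g : RatFunc ℝ} (hg : Transcendental ℝ g) (x : ℝ) :
    compHom g hg (RatFunc.C x) = RatFunc.C x := by
  rw [compHom, RatFunc.liftRingHom_C]; simp

theorem compHom_comp_C {g : RatFunc ℝ} (hg : Transcendental ℝ g) :
    (compHom g hg).comp RatFunc.C = RatFunc.C :=
  RingHom.ext fun x => compHom_C hg x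

theorem comp_comp {h : RatFunc ℝ} (hh : Transcendental ℝ h) (f g : RatFunc ℝ) :
    comp (comp f g) h = comp f (comp g h) := by
  rw [← compHom_apply hh, comp_eq f g, map_div₀, Polynomial.hom_eval₂, Polynomial.hom_eval₂,
    compHom_comp_C, compHom_apply, comp_eq f]

theorem comp_X (f : RatFunc ℝ) : comp f RatFunc.X = f := by
  rw [comp_eq, ← RatFunc.algebraMap_X, ← RatFunc.algebraMap_comp_C, ← Polynomial.hom_eval₂,
    ← Polynomial.hom_eval₂, Polynomial.eval₂_C_X, Polynomial.eval₂_C_X, RatFunc.num_div_denom]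

theorem X_comp (g : RatFunc ℝ) : comp RatFunc.X g = g := by
  rw [comp, RatFunc.eval_X]

/-- Substitution may be computed from an unreduced fraction, since the reduced denominator divides
`q`. -/
theorem comp_of_mul_eq {f g : RatFunc ℝ} {p q : ℝ[X]}
    (hf : f = algebraMap ℝ[X] (RatFunc ℝ) p / algebraMap ℝ[X] (RatFunc ℝ) q)
    (hq : q.eval₂ RatFunc.C g ≠ 0) :
    comp f g = p.eval₂ RatFunc.C g / q.eval₂ RatFunc.C g := by
  have hq0 : q ≠ 0 := by rintro rfl; simp at hq
  have h := (RatFunc.num_mul_eq_mul_denom_iff hq0).2 hf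
  obtain ⟨r, hr⟩ := (RatFunc.denom_dvd (x := f) hq0).2 ⟨p, hf⟩
  have hd : f.denom.eval₂ RatFunc.C g ≠ 0 := by
    intro h0
    rw [hr, Polynomial.eval₂_mul, h0, zero_mul] at hq
    exact hq rfl
  have := congrArg (Polynomial.eval₂ RatFunc.C g) h
  rw [Polynomial.eval₂_mul, Polynomial.eval₂_mul] at this
  rw [comp_eq, div_eq_div_iff hd hq, this]

theorem beta_comp {g : RatFunc ℝ} (hg : 1 + g ≠ 0) : comp beta g = (1 - g) / (1 + g) := by
  have := comp_of_mul_eq (f := beta) (g := g) (p := 1 - X) (q := 1 + X)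
    (by simp [beta]) (by simpa using hg)
  simpa using this

theorem transcendental_X : Transcendental ℝ (RatFunc.X : RatFunc ℝ) := RatFunc.transcendental_X

theorem transcendental_neg_X : Transcendental ℝ (-RatFunc.X : RatFunc ℝ) := fun h =>
  transcendental_X (by simpa using h.neg)

theorem transcendental_inv_X : Transcendental ℝ (RatFunc.X⁻¹ : RatFunc ℝ) := fun h =>
  transcendental_X (IsAlgebraic.inv_iff.1 h)

theorem one_add_ne_zero_of_transcendental {g : RatFunc ℝ} (hg : Transcendental ℝ g) :
    1 + g ≠ 0 := by
  have := eval₂_C_ne_zero hg (p := 1 + X) (by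
    intro h; simpa using congrArg (Polynomial.eval 0) h)
  simpa using this

theorem transcendental_beta : Transcendental ℝ beta := fun h => by
  have h1 : (1 : RatFunc ℝ) + RatFunc.X ≠ 0 := one_add_ne_zero_of_transcendental transcendental_X
  have hX : RatFunc.X = (1 - beta) * (1 + beta)⁻¹ := by
    have h2 : 1 + beta = 2 / (1 + RatFunc.X) := by
      rw [beta]; field_simp; ring
    rw [h2, beta]; field_simp; ring
  exact transcendental_X (hX ▸ ((isAlgebraic_one.sub h).mul (isAlgebraic_one.add h).inv))

theorem beta_comp_beta : comp beta beta = RatFunc.X := by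
  have h1 : (1 : RatFunc ℝ) + RatFunc.X ≠ 0 := one_add_ne_zero_of_transcendental transcendental_X
  have h2 : 1 + beta = 2 / (1 + RatFunc.X) := by
    rw [beta]; field_simp; ring
  rw [beta_comp (one_add_ne_zero_of_transcendental transcendental_beta), h2, beta]
  field_simp; ring

/-- With `beta_comp_inv_X`: `β` interchanges `z ↦ -z` and `z ↦ z⁻¹`, so all-pass becomes a rule
under `z ↦ -z` and evenness the symmetry under inversion. -/
theorem beta_comp_neg_X : comp beta (-RatFunc.X) = comp RatFunc.X⁻¹ beta := by
  rw [beta_comp (one_add_ne_zero_of_transcendental transcendental_neg_X),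
    ← compHom_apply transcendental_beta, map_inv₀, compHom_apply, X_comp, beta, inv_div]
  ring

theorem beta_comp_inv_X : comp beta RatFunc.X⁻¹ = comp (-RatFunc.X) beta := by
  have h1 : (1 : RatFunc ℝ) + RatFunc.X ≠ 0 := one_add_ne_zero_of_transcendental transcendental_X
  have h2 := one_add_ne_zero_of_transcendental transcendental_inv_X
  have hX : (RatFunc.X : RatFunc ℝ) ≠ 0 := RatFunc.X_ne_zero
  rw [beta_comp h2, ← compHom_apply transcendental_beta, map_neg, compHom_apply, X_comp, beta]
  have h3 : (RatFunc.X : RatFunc ℝ) + 1 ≠ 0 := by rwa [add_comm]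
  field_simp
  ring

theorem sq_add_one_ne_zero (f : RatFunc ℝ) : f ^ 2 + 1 ≠ 0 := by
  intro h
  have hd := RatFunc.algebraMap_ne_zero f.denom_ne_zero
  rw [← RatFunc.num_div_denom f, div_pow] at h
  field_simp at h
  have h2 : f.num ^ 2 + f.denom ^ 2 = 0 := by
    apply RatFunc.algebraMap_injective ℝ
    simpa using h
  refine f.denom_ne_zero (Polynomial.funext fun x => ?_)
  have := congrArg (Polynomial.eval x) h2
  simp only [Polynomial.eval_add, Polynomial.eval_pow, Polynomial.eval_zero] at this ⊢
  nlinarith [sq_nonneg (f.num.eval x), sq_nonneg (f.denom.eval x)]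

theorem sqrtTwo_sq : sqrtTwo ^ 2 = 2 := by
  rw [sqrtTwo, ← map_pow, Real.sq_sqrt (by norm_num)]
  exact map_ofNat _ 2

theorem compHom_sqrtTwo {g : RatFunc ℝ} (hg : Transcendental ℝ g) :
    compHom g hg sqrtTwo = sqrtTwo := compHom_C hg _

theorem sqrtTwo_ne_zero : sqrtTwo ≠ 0 := by
  intro h
  have := sqrtTwo_sq
  rw [h] at this
  norm_num at this

/-- Otherwise `a` is the constant `-1/√2`, whose square is not `1`. -/
theorem one_add_sqrtTwo_mul_ne_zero {a : RatFunc ℝ} (ha : IsAllPass a) : 1 + sqrtTwo * a ≠ 0 := by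
  intro h
  have h2 := congrArg (compHom _ transcendental_inv_X) h
  rw [map_add, map_mul, map_one, map_zero, compHom_sqrtTwo, compHom_apply] at h2
  have h3 : a * comp a RatFunc.X⁻¹ = 1 := ha
  have h4 : (2 : RatFunc ℝ) = 1 := by
    rw [← sqrtTwo_sq]
    linear_combination sqrtTwo * comp a RatFunc.X⁻¹ * h - h2 - sqrtTwo ^ 2 * h3
  norm_num at h4

/-- Everything is expressed through `A = a ∘ β`, which satisfies `A(-z) = A⁻¹` and `A(z⁻¹) = A`.
With `D = 1 + √2 A + A²` one finds `H = A(√2 + A)/D` and `H(-z) = (1 + √2 A)/D`; the claims are then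
identities in `A`. -/
theorem filterOfAllPass_spec {a : RatFunc ℝ} (ha : IsAllPass a) (he : IsEven a) :
    IsZeroSymFilter (filterOfAllPass a) ∧ allPassOfFilter (filterOfAllPass a) = a := by
  set A := comp a beta with hA
  have hAdef : compHom _ transcendental_beta a = A := compHom_apply _ _
  have hW := one_add_sqrtTwo_mul_ne_zero ha
  have hV : 1 + sqrtTwo * A ≠ 0 := by
    have := (_root_.map_ne_zero (compHom _ transcendental_beta)).2 hW
    rwa [map_add, map_mul, map_one, compHom_sqrtTwo, hAdef] at this
  have hs := sqrtTwo_sq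
  have hs0 := sqrtTwo_ne_zero
  have hD : 1 + sqrtTwo * A + A ^ 2 ≠ 0 := by
    have h1 := sq_add_one_ne_zero (sqrtTwo * A + 1)
    have h2 : (sqrtTwo * A + 1) ^ 2 + 1 = 2 * (1 + sqrtTwo * A + A ^ 2) := by
      linear_combination A ^ 2 * hs
    rw [h2] at h1
    exact right_ne_zero_of_mul h1
  have hAneg : compHom _ transcendental_neg_X A = A⁻¹ := by
    rw [compHom_apply, hA, comp_comp transcendental_neg_X, beta_comp_neg_X,
      ← comp_comp transcendental_beta, eq_inv_of_mul_eq_one_right ha,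
      ← compHom_apply transcendental_beta, map_inv₀, compHom_apply]
  have hA0 : A ≠ 0 := by
    rw [← hAdef]
    exact (_root_.map_ne_zero _).2 (left_ne_zero_of_mul_eq_one ha)
  have hAinv : compHom _ transcendental_inv_X A = A := by
    have he' : comp a (-RatFunc.X) = a := he
    rw [compHom_apply, hA, comp_comp transcendental_inv_X, beta_comp_inv_X,
      ← comp_comp transcendental_beta, he']
  have hH : filterOfAllPass a = A * (sqrtTwo + A) / (1 + sqrtTwo * A + A ^ 2) := by
    have h1 := sq_add_one_ne_zero (1 + sqrtTwo * a)
    have h2 : 1 + 1 / (1 + sqrtTwo * a) ^ 2 ≠ 0 := by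
      have : 1 + 1 / (1 + sqrtTwo * a) ^ 2 =
        ((1 + sqrtTwo * a) ^ 2 + 1) / (1 + sqrtTwo * a) ^ 2 := by field_simp
      rw [this]
      exact div_ne_zero h1 (pow_ne_zero 2 hW)
    have h3 : (1 + sqrtTwo * A) ^ 2 + 1 ≠ 0 := sq_add_one_ne_zero _
    have h4 : (1 - 1 / (1 + sqrtTwo * a) ^ 2) / (1 + 1 / (1 + sqrtTwo * a) ^ 2) =
        ((1 + sqrtTwo * a) ^ 2 - 1) / ((1 + sqrtTwo * a) ^ 2 + 1) := by
      field_simp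
    rw [filterOfAllPass, beta_comp h2, h4, ← compHom_apply transcendental_beta]
    simp only [map_div₀, map_sub, map_add, map_mul, map_pow, map_one, compHom_sqrtTwo, hAdef]
    rw [div_eq_div_iff h3 hD]
    linear_combination (A ^ 2 * (1 + sqrtTwo * A + A ^ 2)- A ^ 3 * (sqrtTwo + A)) * hs
  have hHneg : comp (filterOfAllPass a) (-RatFunc.X) =
      (1 + sqrtTwo * A) / (1 + sqrtTwo * A + A ^ 2) := by
    rw [← compHom_apply transcendental_neg_X, hH]
    simp only [map_div₀, map_add, map_mul, map_pow, map_one, compHom_sqrtTwo, hAneg]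
    have : (1 : RatFunc ℝ) + sqrtTwo * A⁻¹ + A⁻¹ ^ 2 = (1 + sqrtTwo * A + A ^ 2) / A ^ 2 := by
      field_simp; ring
    rw [this]
    field_simp
    ring
  refine ⟨⟨?_, ?_⟩, ?_⟩
  · rw [hHneg, hH]
    rw [div_pow, div_pow, ← add_div, div_eq_one_iff_eq (pow_ne_zero 2 hD)]
    linear_combination A ^ 2 * hs
  · rw [← compHom_apply transcendental_inv_X, hH]
    simp only [map_div₀, map_add, map_mul, map_pow, map_one, compHom_sqrtTwo, hAinv]
  · have : (1 + filterOfAllPass a - comp (filterOfAllPass a) (-RatFunc.X)) /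
        (sqrtTwo * comp (filterOfAllPass a) (-RatFunc.X)) = A := by
      rw [hHneg, hH]
      generalize hDd : 1 + sqrtTwo * A + A ^ 2 = D at *
      rw [div_eq_iff (mul_ne_zero hs0 (div_ne_zero hV hD))]
      field_simp
      linear_combination -hDd - A ^ 2 * hs
    rw [allPassOfFilter, this, hA, comp_comp transcendental_beta, beta_comp_beta, comp_X]

theorem Corresponds.spec {a H : RatFunc ℝ} (h : Corresponds a H) :
    IsZeroSymFilter H ∧ a = allPassOfFilter H := by
  rcases h with ⟨ha, he, rfl⟩ | h
  · exact ⟨(filterOfAllPass_spec ha he).1, (filterOfAllPass_spec ha he).2.symm⟩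
  · exact h

/-! ### Multiplicities of zeros and poles -/

/-- The cleared denominator is a power of `1 + X`, a unit at `0`, and `β(0) = 1`; so nonvanishing at
`1` passes to nonvanishing at `0`. -/
theorem exists_eval₂_beta_mul_pow (p : ℝ[X]) : ∃ (k : ℕ) (q : ℝ[X]),
    p.eval₂ RatFunc.C beta * (1 + RatFunc.X) ^ k = algebraMap ℝ[X] (RatFunc ℝ) q ∧
      q.eval 0 = p.eval 1 := by
  have h1 : (1 : RatFunc ℝ) + RatFunc.X ≠ 0 := one_add_ne_zero_of_transcendental transcendental_X
  induction p using Polynomial.induction_on with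
  | C c => exact ⟨0, Polynomial.C c, by simp, by simp⟩
  | add p q hp hq =>
    obtain ⟨k, P, hP, hP0⟩ := hp
    obtain ⟨l, Q, hQ, hQ0⟩ := hq
    refine ⟨k + l, P * (1 + X) ^ l + Q * (1 + X) ^ k, ?_, by simp [hP0, hQ0]⟩
    simp only [map_add, map_mul, map_pow, map_one, RatFunc.algebraMap_X, ← hP, ← hQ,
      Polynomial.eval₂_add]
    ring
  | monomial n c ih =>
    obtain ⟨k, P, hP, hP0⟩ := ih
    refine ⟨k + 1, P * (1 - X), ?_, ?_⟩
    · rw [pow_succ X, ← mul_assoc, Polynomial.eval₂_mul, Polynomial.eval₂_X, map_mul, ← hP]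
      have hb : beta * (1 + RatFunc.X) = 1 - RatFunc.X := div_mul_cancel₀ _ h1
      simp only [map_sub, map_one, RatFunc.algebraMap_X]
      linear_combination
        Polynomial.eval₂ RatFunc.C beta (Polynomial.C c * X ^ n) * (1 + RatFunc.X) ^ k * hb
    · simp [hP0]

theorem rootMultiplicity_neg_one_comp_neg_X (p : ℝ[X]) :
    (p.comp (-X)).rootMultiplicity 1 = p.rootMultiplicity (-1) := by
  have := Polynomial.rootMultiplicity_comp_C_mul_X_add_C p (-1) 0 1 (by simp)
  simpa using this

theorem zeroMultiplicity_div {p q : ℝ[X]} (hp : p ≠ 0) (hq : q ≠ 0) (h : IsCoprime p q) (c : ℝ) :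
    zeroMultiplicity (algebraMap ℝ[X] (RatFunc ℝ) p / algebraMap ℝ[X] (RatFunc ℝ) q) c =
      p.rootMultiplicity c := by
  set f := algebraMap ℝ[X] (RatFunc ℝ) p / algebraMap ℝ[X] (RatFunc ℝ) q with hf
  have e := (RatFunc.num_mul_eq_mul_denom_iff hq).2 hf
  have hf0 : f.num ≠ 0 := RatFunc.num_ne_zero
    (div_ne_zero (RatFunc.algebraMap_ne_zero hp) (RatFunc.algebraMap_ne_zero hq))
  apply le_antisymm
  · exact Polynomial.rootMultiplicity_le_rootMultiplicity_of_dvd hp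
      ((RatFunc.isCoprime_num_denom f).dvd_of_dvd_mul_right (Dvd.intro _ e)) c
  · exact Polynomial.rootMultiplicity_le_rootMultiplicity_of_dvd hf0
      (h.dvd_of_dvd_mul_right (Dvd.intro _ e.symm)) c

/-- The fraction `q / p` need not be reduced: as `q` does not vanish at `c`, no cancellation affects
the order there. -/
theorem poleMultiplicity_eq_of_mul_eq {f : RatFunc ℝ} {p q : ℝ[X]} {c : ℝ} (hp : p ≠ 0)
    (h : f * algebraMap ℝ[X] (RatFunc ℝ) p = algebraMap ℝ[X] (RatFunc ℝ) q)
    (hq : q.eval c ≠ 0) : poleMultiplicity f c = p.rootMultiplicity c := by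
  have hq0 : q ≠ 0 := by rintro rfl; simp at hq
  have e := (RatFunc.num_mul_eq_mul_denom_iff (x := f) hp).2
    (eq_div_of_mul_eq (RatFunc.algebraMap_ne_zero hp) h)
  have hd0 := f.denom_ne_zero
  have hn0 : f.num ≠ 0 := by
    intro h0
    rw [h0, zero_mul] at e
    exact mul_ne_zero hq0 hd0 e.symm
  have hm := congrArg (Polynomial.rootMultiplicity c) e
  rw [Polynomial.rootMultiplicity_mul (mul_ne_zero hn0 hp),
    Polynomial.rootMultiplicity_mul (mul_ne_zero hq0 hd0),
    Polynomial.rootMultiplicity_eq_zero (p := q) hq] at hm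
  rw [poleMultiplicity]
  by_cases hn : f.num.eval c = 0
  · have hd : f.denom.eval c ≠ 0 := by
      intro hd
      obtain ⟨u, v, huv⟩ := RatFunc.isCoprime_num_denom f
      have := congrArg (Polynomial.eval c) huv
      simp [hn, hd] at this
    have := (Polynomial.rootMultiplicity_pos hn0).2 hn
    have := Polynomial.rootMultiplicity_eq_zero (p := f.denom) hd
    omega
  · have := Polynomial.rootMultiplicity_eq_zero (p := f.num) hn
    omega

section

variable {H : RatFunc ℝ}

theorem eval_denom_one_ne_zero (hn : IsNormalized H) : H.denom.eval 1 ≠ 0 := by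
  rw [isNormalized_iff] at hn
  intro h
  simp [h] at hn

theorem eval_num_one (hn : IsNormalized H) : H.num.eval 1 = H.denom.eval 1 := by
  have := eval_denom_one_ne_zero hn
  rw [isNormalized_iff] at hn
  field_simp at hn
  exact hn

theorem eval_num_neg_one (hH : IsZeroSymFilter H) (hn : IsNormalized H) : H.num.eval (-1) = 0 := by
  have h := congrArg (Polynomial.eval 1) (num_denom_quadrature hH)
  have hd := eval_denom_one_ne_zero hn
  simp only [Polynomial.eval_add, Polynomial.eval_mul, Polynomial.eval_pow, Polynomial.eval_comp,
    Polynomial.eval_neg, Polynomial.eval_X, eval_num_one hn] at h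
  have : H.num.eval (-1) ^ 2 * H.denom.eval 1 ^ 2 = 0 := by linear_combination h
  simpa [hd] using this

theorem eval_denom_neg_one_ne_zero (hH : IsZeroSymFilter H) (hn : IsNormalized H) :
    H.denom.eval (-1) ≠ 0 := by
  intro h
  obtain ⟨u, v, huv⟩ := RatFunc.isCoprime_num_denom H
  have := congrArg (Polynomial.eval (-1)) huv
  simp [h, eval_num_neg_one hH hn] at this

theorem num_ne_zero_of_isNormalized (hn : IsNormalized H) : H.num ≠ 0 := by
  intro h
  have := eval_num_one hn
  rw [h, Polynomial.eval_zero] at this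
  exact eval_denom_one_ne_zero hn this.symm

theorem denom_sub_num_ne_zero (hH : IsZeroSymFilter H) :
    H.denom - H.num ≠ 0 := by
  intro h
  have e := num_denom_quadrature hH
  rw [← sub_eq_zero.1 h] at e
  have h2 : (H.denom.comp (-X)) ^ 2 * H.denom ^ 2 = 0 := by linear_combination e
  exact mul_ne_zero (pow_ne_zero 2 (comp_neg_X_ne_zero H.denom_ne_zero))
    (pow_ne_zero 2 H.denom_ne_zero) h2

theorem zeroMultiplicity_one_sub (hH : IsZeroSymFilter H) (c : ℝ) :
    zeroMultiplicity (1 - H) c = (H.denom - H.num).rootMultiplicity c := by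
  have hd := RatFunc.algebraMap_ne_zero H.denom_ne_zero
  have e : 1 - H = algebraMap ℝ[X] (RatFunc ℝ) (H.denom - H.num) /
      algebraMap ℝ[X] (RatFunc ℝ) H.denom := by
    nth_rewrite 1 [← RatFunc.num_div_denom H]
    rw [map_sub]
    field_simp
  rw [e, zeroMultiplicity_div (denom_sub_num_ne_zero hH) H.denom_ne_zero]
  obtain ⟨u, v, huv⟩ := RatFunc.isCoprime_num_denom H
  exact ⟨-u, u + v, by linear_combination huv⟩

/-- `(1 - H)(1 + H) = H(-z)²` compares the multiplicities at `1` and `-1`. -/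
theorem zeroMultiplicity_one_sub_one (hH : IsZeroSymFilter H) (hn : IsNormalized H) :
    zeroMultiplicity (1 - H) 1 = 2 * zeroMultiplicity H (-1) := by
  rw [zeroMultiplicity_one_sub hH, zeroMultiplicity, ← rootMultiplicity_neg_one_comp_neg_X]
  have hd1 := eval_denom_one_ne_zero hn
  have e : (H.denom - H.num) * ((H.denom + H.num) * (H.denom.comp (-X)) ^ 2) =
      (H.num.comp (-X)) ^ 2 * H.denom ^ 2 := by
    linear_combination -num_denom_quadrature hH
  have h1 : ((H.denom + H.num) * (H.denom.comp (-X)) ^ 2).eval 1 ≠ 0 := by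
    simp only [Polynomial.eval_mul, Polynomial.eval_add, Polynomial.eval_pow,
      Polynomial.eval_comp, Polynomial.eval_neg, Polynomial.eval_X, eval_num_one hn, ← two_mul]
    exact mul_ne_zero (mul_ne_zero two_ne_zero hd1)
      (pow_ne_zero 2 (eval_denom_neg_one_ne_zero hH hn))
  have h2 : (H.denom ^ 2).eval 1 ≠ 0 := by simpa using hd1
  have hm := congrArg (Polynomial.rootMultiplicity 1) e
  have hp' := comp_neg_X_ne_zero (num_ne_zero_of_isNormalized hn)
  rw [Polynomial.rootMultiplicity_mul (mul_ne_zero (denom_sub_num_ne_zero hH)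
      (by intro h; simp [h] at h1)), Polynomial.rootMultiplicity_eq_zero h1,
    Polynomial.rootMultiplicity_mul (mul_ne_zero (pow_ne_zero 2 hp')
      (pow_ne_zero 2 H.denom_ne_zero)), Polynomial.rootMultiplicity_eq_zero h2, sq,
    Polynomial.rootMultiplicity_mul (mul_ne_zero hp' hp')] at hm
  omega

theorem poleMultiplicity_allPassOfFilter (hH : IsZeroSymFilter H) (hn : IsNormalized H) :
    poleMultiplicity (allPassOfFilter H) 0 = zeroMultiplicity H (-1) := by
  set p := H.num with hp
  set d := H.denom with hd
  set p' := p.comp (-X) with hp'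
  set d' := d.comp (-X) with hd'
  have hp0 : p ≠ 0 := num_ne_zero_of_isNormalized hn
  have hd0 : d ≠ 0 := H.denom_ne_zero
  have hp'0 : p' ≠ 0 := comp_neg_X_ne_zero hp0
  have hd'0 : d' ≠ 0 := comp_neg_X_ne_zero hd0
  have h1X : (1 : RatFunc ℝ) + RatFunc.X ≠ 0 := one_add_ne_zero_of_transcendental transcendental_X
  have hs0 : Real.sqrt 2 ≠ 0 := by positivity
  set n := p'.rootMultiplicity 1 with hn'
  obtain ⟨r, hr, hr1⟩ := Polynomial.exists_eq_pow_rootMultiplicity_mul_and_not_dvd p' hp'0 1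
  rw [Polynomial.dvd_iff_isRoot, Polynomial.IsRoot] at hr1
  -- Before substitution the fraction is `U / ((X - 1)ⁿ V)`, with `U` and `V` nonzero at `1`.
  set U : ℝ[X] := (d + p) * d' - p' * d with hU
  set V : ℝ[X] := Polynomial.C (Real.sqrt 2) * r * d with hV
  have hVe : V.eval 1 ≠ 0 := by
    simp only [hV, Polynomial.eval_mul, Polynomial.eval_C]
    exact mul_ne_zero (mul_ne_zero hs0 hr1) (eval_denom_one_ne_zero hn)
  have hV0 : V ≠ 0 := by rintro h; simp [h] at hVe
  have hUe : U.eval 1 ≠ 0 := by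
    have h2 : U.eval 1 = 2 * d.eval 1 * d.eval (-1) := by
      simp only [hU, hp', hd', Polynomial.eval_sub, Polynomial.eval_mul, Polynomial.eval_add,
        Polynomial.eval_comp, Polynomial.eval_neg, Polynomial.eval_X, hp, hd, eval_num_one hn,
        eval_num_neg_one hH hn]
      ring
    rw [h2]
    exact mul_ne_zero (mul_ne_zero two_ne_zero (eval_denom_one_ne_zero hn))
      (eval_denom_neg_one_ne_zero hH hn)
  have hV' : (X - Polynomial.C 1) ^ n * V = Polynomial.C (Real.sqrt 2) * p' * d := by
    rw [hr, hV]; ring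
  have hF : (1 + H - comp H (-RatFunc.X)) / (sqrtTwo * comp H (-RatFunc.X)) =
      algebraMap ℝ[X] (RatFunc ℝ) U /
        algebraMap ℝ[X] (RatFunc ℝ) ((X - Polynomial.C 1) ^ n * V) := by
    have a1 := RatFunc.algebraMap_ne_zero hd0
    have a2 := RatFunc.algebraMap_ne_zero hd'0
    have a3 := RatFunc.algebraMap_ne_zero hp'0
    have a4 := sqrtTwo_ne_zero
    rw [hV', comp_neg_X, hU]
    nth_rewrite 1 [← RatFunc.num_div_denom H]
    simp only [map_mul, map_sub, map_add, RatFunc.algebraMap_C, ← hp, ← hd, ← hp', ← hd']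
    rw [← sqrtTwo]
    field_simp
  have hVβ : ((X - Polynomial.C 1) ^ n * V).eval₂ RatFunc.C beta ≠ 0 :=
    eval₂_C_ne_zero transcendental_beta
      (mul_ne_zero (pow_ne_zero n (Polynomial.X_sub_C_ne_zero 1)) hV0)
  have ha := comp_of_mul_eq hF hVβ
  rw [eq_div_iff hVβ] at ha
  obtain ⟨k, U', hU', hU'0⟩ := exists_eval₂_beta_mul_pow U
  obtain ⟨l, V', hV'', hV'0⟩ := exists_eval₂_beta_mul_pow V
  have hX1 (j : ℕ) : ((1 + X : ℝ[X]) ^ j).eval 0 ≠ 0 := by simp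
  -- `β - 1` has a simple zero at `0`, so `(X - 1)ⁿ` becomes `Xⁿ` up to units at `0`.
  have hβ : (X - Polynomial.C 1 : ℝ[X]).eval₂ RatFunc.C beta * (1 + RatFunc.X) =
      -2 * RatFunc.X := by
    simp only [Polynomial.eval₂_sub, Polynomial.eval₂_X, Polynomial.eval₂_one, map_one, beta]
    field_simp; ring
  have hmain : allPassOfFilter H * algebraMap ℝ[X] (RatFunc ℝ)
      ((X - Polynomial.C 0) ^ n * (Polynomial.C ((-2) ^ n) * V' * (1 + X) ^ k)) =
      algebraMap ℝ[X] (RatFunc ℝ) (U' * (1 + X) ^ (n + l)) := by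
    have e2 : (RatFunc.C (-2 : ℝ)) = -2 := by
      rw [map_neg]; congr 1; exact map_ofNat _ 2
    rw [Polynomial.eval₂_mul, Polynomial.eval₂_pow] at ha
    simp only [map_mul, map_pow, map_add, map_one, map_zero, RatFunc.algebraMap_X,
      RatFunc.algebraMap_C, ← hU', ← hV'', sub_zero, e2]
    rw [allPassOfFilter, ← ha]
    have : (RatFunc.X : RatFunc ℝ) ^ n * (-2) ^ n =
        (X - Polynomial.C 1 : ℝ[X]).eval₂ RatFunc.C beta ^ n * (1 + RatFunc.X) ^ n := by
      rw [← mul_pow, ← mul_pow, hβ, mul_comm]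
    linear_combination (comp ((1 + H - comp H (-RatFunc.X)) / (sqrtTwo * comp H (-RatFunc.X))) beta)
      * (Polynomial.eval₂ RatFunc.C beta V * (1 + RatFunc.X) ^ l * (1 + RatFunc.X) ^ k) * this
  have hrest : (Polynomial.C ((-2) ^ n) * V' * (1 + X) ^ k : ℝ[X]).eval 0 ≠ 0 := by
    simp only [Polynomial.eval_mul, Polynomial.eval_C, hV'0]
    exact mul_ne_zero (mul_ne_zero (by positivity) hVe) (hX1 k)
  have hrest0 : (Polynomial.C ((-2) ^ n) * V' * (1 + X) ^ k : ℝ[X]) ≠ 0 := by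
    intro h; rw [h, Polynomial.eval_zero] at hrest; exact hrest rfl
  have hX0 : ((X - Polynomial.C 0 : ℝ[X]) ^ n) ≠ 0 := pow_ne_zero n (Polynomial.X_sub_C_ne_zero 0)
  rw [poleMultiplicity_eq_of_mul_eq (mul_ne_zero hX0 hrest0) hmain
    (by rw [Polynomial.eval_mul, hU'0]; exact mul_ne_zero hUe (hX1 _)),
    Polynomial.rootMultiplicity_mul (mul_ne_zero hX0 hrest0),
    Polynomial.rootMultiplicity_X_sub_C_pow, Polynomial.rootMultiplicity_eq_zero hrest,
    zeroMultiplicity, ← rootMultiplicity_neg_one_comp_neg_X, add_zero]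

end

/-! ### Scaling function and wavelet: existence, uniqueness, moments -/

theorem exists_angularFourier_eq {F : ℝ → ℂ} (hF : MemLp F 2) :
    ∃ f : Lp (α := ℝ) ℂ 2 volume, angularFourier f =ᵐ[volume] F := by
  have hpi : (2 * Real.pi) ≠ 0 := by positivity
  have hE := memLp_comp_mul_right hF hpi
  refine ⟨𝓕⁻ hE.toLp, ?_⟩
  have h1 : (𝓕 (𝓕⁻ hE.toLp) : Lp (α := ℝ) ℂ 2 volume) =ᵐ[volume]
      fun x => F (x * (2 * Real.pi)) := by
    rw [FourierTransform.fourier_fourierInv_eq]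
    exact MemLp.coeFn_toLp hE
  filter_upwards [ae_comp_mul_right h1 (inv_ne_zero hpi)] with ξ h
  rw [angularFourier, div_eq_mul_inv, h, mul_assoc, inv_mul_cancel₀ hpi, mul_one]

/-- The holomorphic extension `-e^{-iz} M(z + π)` of the wavelet filter. -/
def mirrorFilter (M : ℂ → ℂ) (z : ℂ) : ℂ := -Complex.exp (-Complex.I * z) * M (z + Real.pi)

/-- The holomorphic extension of the Fourier transform of the wavelet. -/
def waveletCascade (M : ℂ → ℂ) (z : ℂ) : ℂ := mirrorFilter M (z / 2) * cascade M (z / 2)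

theorem freqResponse_eq (H : RatFunc ℝ) (ξ : ℝ) : freqResponse H ξ = complexResponse H ξ := rfl

theorem waveletResponse_eq {H : RatFunc ℝ} (hH : IsZeroSymFilter H) (ξ : ℝ) :
    waveletResponse H ξ = mirrorFilter (complexResponse H) ξ := by
  rw [waveletResponse, mirrorFilter, freqResponse_eq, conj_complexResponse hH, Complex.ofReal_add]

namespace IsStripSymbol

variable {M : ℂ → ℂ} {δ C : ℝ}

theorem div_two_mem_strip {z : ℂ} (hz : z ∈ strip δ) : z / 2 ∈ strip δ := by
  simpa using div_two_pow_mem_strip hz 1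

theorem add_pi_mem_strip {z : ℂ} (hz : z ∈ strip δ) : z + Real.pi ∈ strip δ := by
  simpa [strip] using hz

theorem differentiableOn_mirrorFilter (h : IsStripSymbol M δ C) :
    DifferentiableOn ℂ (mirrorFilter M) (strip δ) := by
  refine DifferentiableOn.mul (by fun_prop) (h.differentiableOn.comp (by fun_prop) fun z hz => ?_)
  exact add_pi_mem_strip hz

theorem differentiableOn_waveletCascade (h : IsStripSymbol M δ C) :
    DifferentiableOn ℂ (waveletCascade M) (strip δ) :=
  (h.differentiableOn_mirrorFilter.comp (by fun_prop) fun _ hz => div_two_mem_strip hz).mul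
    (h.differentiableOn_cascade.comp (by fun_prop) fun _ hz => div_two_mem_strip hz)

/-- The exponential is at most `exp δ`, and `M` differs by at most `C * δ` from a value on the real
line, where it is bounded by `1`. -/
theorem norm_mirrorFilter_le (h : IsStripSymbol M δ C) (ξ : ℝ) {w : ℂ} (hw : ‖w‖ < δ) :
    ‖mirrorFilter M (ξ + w)‖ ≤ Real.exp δ * (1 + C * δ) := by
  rw [mirrorFilter, norm_mul, norm_neg, Complex.norm_exp]
  have h1 : (-Complex.I * (ξ + w)).re ≤ δ := by
    simpa using ((Complex.abs_im_le_norm w).trans hw.le).trans' (le_abs_self _)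
  have h2 := h.lipschitz _ (add_pi_mem_strip (ofReal_add_mem_strip ξ hw)) _
    (ofReal_mem_strip h.pos (ξ + Real.pi))
  have h3 : (ξ : ℂ) + w + Real.pi - ((ξ + Real.pi : ℝ) : ℂ) = w := by push_cast; ring
  rw [h3] at h2
  have h4 := norm_sub_norm_le (M (ξ + w + Real.pi)) (M ((ξ + Real.pi : ℝ)))
  have h5 := h.norm_le_one (ξ + Real.pi)
  have h6 := mul_le_mul_of_nonneg_left hw.le h.nonneg
  have := h.nonneg
  gcongr
  linarith

theorem exists_majorant_waveletCascade (h : IsStripSymbol M δ C) :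
    ∃ G : ℝ → ℝ, MemLp G 2 ∧ ∀ (ξ : ℝ) (w : ℂ), ‖w‖ < δ → ‖waveletCascade M (ξ + w)‖ ≤ G ξ := by
  obtain ⟨G, hG, hGb⟩ := h.exists_majorant
  have hG2 : MemLp (fun ξ => G (ξ * 2⁻¹)) 2 := by
    have := memLp_comp_mul_right (f := fun ξ => (G ξ : ℂ)) hG.ofReal (inv_ne_zero two_ne_zero)
    simpa using this.re
  refine ⟨_, hG2.const_mul (Real.exp δ * (1 + C * δ)), fun ξ w hw => ?_⟩
  have hw2 : ‖w / 2‖ < δ := by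
    rw [norm_div, Complex.norm_ofNat]
    linarith [norm_nonneg w]
  have e : ((ξ : ℂ) + w) / 2 = ((ξ * 2⁻¹ : ℝ) : ℂ) + w / 2 := by push_cast; ring
  rw [waveletCascade, e, norm_mul]
  have := h.nonneg
  have := h.pos
  exact mul_le_mul (h.norm_mirrorFilter_le _ hw2) (hGb _ _ hw2) (norm_nonneg _) (by positivity)

theorem memLp_iteratedDeriv_cascade (h : IsStripSymbol M δ C) (k : ℕ) :
    MemLp (fun ξ : ℝ => iteratedDeriv k (cascade M) ξ) 2 := by
  obtain ⟨G, hG, hGb⟩ := h.exists_majorant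
  exact memLp_iteratedDeriv_of_majorant h.pos h.differentiableOn_cascade hG hGb k

theorem memLp_iteratedDeriv_waveletCascade (h : IsStripSymbol M δ C) (k : ℕ) :
    MemLp (fun ξ : ℝ => iteratedDeriv k (waveletCascade M) ξ) 2 := by
  obtain ⟨G, hG, hGb⟩ := h.exists_majorant_waveletCascade
  exact memLp_iteratedDeriv_of_majorant h.pos h.differentiableOn_waveletCascade hG hGb k

/-- Iterating the refinement equation leaves the remainder `Φ(ξ / 2ⁿ)`, which tends to `1`. Thus
every scaling function, not just the constructed one, has the product as its transform. -/
theorem eq_cascade_of_refinement (h : IsStripSymbol M δ C) {Φ : ℝ → ℂ} (hc : ContinuousAt Φ 0)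
    (h0 : Φ 0 = 1) (hΦ : ∀ ξ : ℝ, Φ (2 * ξ) = M ξ * Φ ξ) (ξ : ℝ) : Φ ξ = cascade M ξ := by
  have hprod (n : ℕ) : Φ ξ =
      (∏ k ∈ Finset.range n, M ((ξ : ℂ) / 2 ^ (k + 1))) * Φ (ξ / 2 ^ n) := by
    induction n with
    | zero => simp
    | succ n ih =>
      rw [ih, Finset.prod_range_succ, mul_assoc]
      have e : ξ / 2 ^ n = 2 * (ξ / 2 ^ (n + 1)) := by rw [pow_succ]; field_simp
      rw [e, hΦ]
      push_cast
      rfl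
  have hlim : Tendsto (fun n : ℕ => ξ / 2 ^ n) atTop (𝓝 0) :=
    tendsto_const_nhds.div_atTop (tendsto_pow_atTop_atTop_of_one_lt one_lt_two)
  have h1 := (h.tendsto_cascade (ofReal_mem_strip h.pos ξ)).mul (hc.tendsto.comp hlim)
  rw [h0, mul_one] at h1
  exact tendsto_nhds_unique tendsto_const_nhds (h1.congr fun n => (hprod n).symm)

/-- Up to the dilation by `1/2`, the function is a product of analytic factors including `M(z + π)`,
so it vanishes at least to that factor's order. -/
theorem iteratedDeriv_waveletCascade_zero (h : IsStripSymbol M δ C) {N : ℕ}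
    (hN : N ≤ analyticOrderAt (fun z => M (z + Real.pi)) 0) {k : ℕ} (hk : k < N) :
    iteratedDeriv k (waveletCascade M) 0 = 0 := by
  have hz0 : (0 : ℂ) ∈ strip δ := by simpa using ofReal_mem_strip h.pos 0
  have h0 : strip δ ∈ 𝓝 (0 : ℂ) := (isOpen_strip δ).mem_nhds hz0
  have ha := h.differentiableOn_cascade.analyticAt h0
  have haw := h.differentiableOn_waveletCascade.analyticAt h0
  have hM : AnalyticAt ℂ M (0 + Real.pi) :=
    h.differentiableOn.analyticAt ((isOpen_strip δ).mem_nhds (add_pi_mem_strip hz0))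
  have haM : AnalyticAt ℂ (fun z => M (z + Real.pi)) 0 :=
    hM.fun_comp (f := fun z : ℂ => z + Real.pi) (by fun_prop)
  have hae : AnalyticAt ℂ (fun z : ℂ => -Complex.exp (-Complex.I * z)) 0 := by fun_prop
  have e : waveletCascade M = ((fun z : ℂ => -Complex.exp (-Complex.I * z)) *
      (fun z => M (z + Real.pi)) * cascade M) ∘ fun z => z / 2 := rfl
  refine (natCast_le_analyticOrderAt_iff_iteratedDeriv_eq_zero haw).1 ?_ k hk
  rw [e, analyticOrderAt_comp_of_deriv_ne_zero (by fun_prop) (by simp), zero_div,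
    analyticOrderAt_mul (hae.mul haM) ha, analyticOrderAt_mul hae haM]
  exact hN.trans (le_add_self.trans le_self_add)

end IsStripSymbol

theorem exists_scalingFunction_wavelet {H : RatFunc ℝ} (hH : IsZeroSymFilter H) {δ C : ℝ}
    (h : IsStripSymbol (complexResponse H) δ C) :
    ∃ φ ψ : Lp (α := ℝ) ℂ 2 volume, IsScalingFunction H φ ∧ IsWavelet H φ ψ := by
  obtain ⟨φ, hφ⟩ := exists_angularFourier_eq (h.memLp_iteratedDeriv_cascade 0)
  obtain ⟨ψ, hψ⟩ := exists_angularFourier_eq (h.memLp_iteratedDeriv_waveletCascade 0)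
  simp only [iteratedDeriv_zero] at hφ hψ
  refine ⟨φ, ψ, ⟨fun ξ => cascade (complexResponse H) ξ, hφ, ?_, ?_, fun ξ => ?_⟩, ?_⟩
  · simpa using
      (hasDerivAt_iteratedDeriv_ofReal h.pos h.differentiableOn_cascade 0 0).continuousAt
  · simpa using h.cascade_zero
  · beta_reduce
    rw [h.cascade_eq (ofReal_mem_strip h.pos _), freqResponse_eq]
    simp
  · filter_upwards [hφ, ae_comp_mul_right hψ two_ne_zero] with ξ h1 h2
    rw [mul_comm 2 ξ, h2, h1, waveletResponse_eq hH, waveletCascade]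
    simp

theorem IsScalingFunction.angularFourier_eq {H : RatFunc ℝ} {δ C : ℝ}
    (h : IsStripSymbol (complexResponse H) δ C) {φ : Lp (α := ℝ) ℂ 2 volume}
    (hφ : IsScalingFunction H φ) :
    angularFourier φ =ᵐ[volume] fun ξ : ℝ => cascade (complexResponse H) ξ := by
  obtain ⟨Φ, h1, hc, h0, hΦ⟩ := hφ
  exact h1.trans (.of_eq (funext fun ξ => h.eq_cascade_of_refinement hc h0 hΦ ξ))

theorem IsWavelet.angularFourier_eq {H : RatFunc ℝ} (hH : IsZeroSymFilter H) {δ C : ℝ}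
    (h : IsStripSymbol (complexResponse H) δ C) {φ ψ : Lp (α := ℝ) ℂ 2 volume}
    (hφ : IsScalingFunction H φ) (hψ : IsWavelet H φ ψ) :
    angularFourier ψ =ᵐ[volume] fun ξ : ℝ => waveletCascade (complexResponse H) ξ := by
  have h2 : (2 : ℝ)⁻¹ ≠ 0 := by norm_num
  filter_upwards [ae_comp_mul_right hψ h2, ae_comp_mul_right (hφ.angularFourier_eq h) h2]
    with ξ h3 h4
  rw [h4, waveletResponse_eq hH] at h3
  rw [waveletCascade]
  simpa [div_eq_mul_inv, mul_comm ξ, mul_comm (ξ : ℂ)] using h3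

theorem hasMoment_scalingFunction {H : RatFunc ℝ} {δ C : ℝ}
    (h : IsStripSymbol (complexResponse H) δ C) {N : ℕ}
    (hN : N ≤ analyticOrderAt (fun z => complexResponse H z - 1) 0)
    {φ : Lp (α := ℝ) ℂ 2 volume} (hφ : IsScalingFunction H φ) {k : ℕ} (hk : k < N) :
    HasMoment φ k (if k = 0 then 1 else 0) := by
  have := hasMoment_of_hasDerivAt φ _
    (hasDerivAt_iteratedDeriv_ofReal h.pos h.differentiableOn_cascade)
    h.memLp_iteratedDeriv_cascade (by simpa using hφ.angularFourier_eq h) k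
  convert this using 1
  rw [Complex.ofReal_zero]
  split_ifs with h0
  · simp [h0, h.cascade_zero]
  · rw [h.iteratedDeriv_cascade_zero hN h0 hk, mul_zero]

theorem hasMoment_wavelet {H : RatFunc ℝ} (hH : IsZeroSymFilter H) {δ C : ℝ}
    (h : IsStripSymbol (complexResponse H) δ C) {N : ℕ}
    (hN : N ≤ analyticOrderAt (fun z => complexResponse H (z + Real.pi)) 0)
    {φ ψ : Lp (α := ℝ) ℂ 2 volume} (hφ : IsScalingFunction H φ) (hψ : IsWavelet H φ ψ) {k : ℕ}
    (hk : k < N) : HasMoment ψ k 0 := by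
  have := hasMoment_of_hasDerivAt ψ _
    (hasDerivAt_iteratedDeriv_ofReal h.pos h.differentiableOn_waveletCascade)
    h.memLp_iteratedDeriv_waveletCascade (by simpa using hψ.angularFourier_eq hH h hφ) k
  rwa [Complex.ofReal_zero, h.iteratedDeriv_waveletCascade_zero hN hk, mul_zero] at this

end ZeroSym
end

theorem corollary1 (a H : RatFunc ℝ) (hcorr : ZeroSym.Corresponds a H)
    (hnorm : ZeroSym.IsNormalized H) (m : ℕ) (hm : 0 < m) :
    [ZeroSym.poleMultiplicity a 0 = 2 * m,
      ZeroSym.zeroMultiplicity H (-1) = 2 * m,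
      ZeroSym.zeroMultiplicity (1 - H) 1 = 4 * m].TFAE ∧
    ((ZeroSym.poleMultiplicity a 0 = 2 * m ∨
        ZeroSym.zeroMultiplicity H (-1) = 2 * m ∨
        ZeroSym.zeroMultiplicity (1 - H) 1 = 4 * m) →
      (∃ φ ψ : Lp (α := ℝ) ℂ 2 volume, ZeroSym.IsScalingFunction H φ ∧ ZeroSym.IsWavelet H φ ψ) ∧
      ∀ φ ψ : Lp (α := ℝ) ℂ 2 volume, ZeroSym.IsScalingFunction H φ → ZeroSym.IsWavelet H φ ψ →
        (∀ k < 2 * m, ZeroSym.HasMoment ψ k 0) ∧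
        (∀ k < 4 * m, ZeroSym.HasMoment φ k (if k = 0 then 1 else 0))) := by
  obtain ⟨hH, rfl⟩ := hcorr.spec
  rw [ZeroSym.poleMultiplicity_allPassOfFilter hH hnorm,
    ZeroSym.zeroMultiplicity_one_sub_one hH hnorm]
  have h31 : 2 * ZeroSym.zeroMultiplicity H (-1) = 4 * m ↔
      ZeroSym.zeroMultiplicity H (-1) = 2 * m := by omega
  rw [h31]
  refine ⟨by tfae_finish, fun hor => ?_⟩
  have h2 : ZeroSym.zeroMultiplicity H (-1) = 2 * m := by tauto
  have h4 := ZeroSym.zeroMultiplicity_one_sub_one hH hnorm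
  rw [ZeroSym.zeroMultiplicity_one_sub hH, h2] at h4
  rw [ZeroSym.zeroMultiplicity] at h2
  obtain ⟨δ, C, h⟩ := ZeroSym.exists_isStripSymbol hH hnorm
  -- The analytic part needs only divisibility by `(X - 1)^(4m)` and `(X + 1)^(2m)`.
  have hd1 := Polynomial.pow_rootMultiplicity_dvd (H.denom - H.num) 1
  have hd2 := Polynomial.pow_rootMultiplicity_dvd H.num (-1)
  rw [h4, show 2 * (2 * m) = 4 * m by ring] at hd1
  rw [h2] at hd2
  exact ⟨ZeroSym.exists_scalingFunction_wavelet hH h, fun φ ψ hφ hψ =>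
    ⟨fun k hk => ZeroSym.hasMoment_wavelet hH h
      (ZeroSym.le_analyticOrderAt_complexResponse_add_pi hH hd2) hφ hψ hk,
    fun k hk => ZeroSym.hasMoment_scalingFunction h
      (ZeroSym.le_analyticOrderAt_complexResponse_sub_one hH hd1) hφ hk⟩⟩
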